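/- Let $n,d\ge 0$ and write points of $\mathbb C^{n+d}$ as $Z=(z,w)\in\mathbb C^n\times\mathbb C^d$. Let $M\subset\mathbb C^{n+d}$ be a real-analytic generic submanifold of (real) codimension $d$ passing through $0$ (generic means $T_pM+iT_pM=\mathbb C^{n+d}$ for all $p\in M$). Let $\Omega\subset\mathbb C^n\times\mathbb C^{n+d}$ be an open neighbourhood of the origin and $Q=(Q^1,\dots,Q^d)\colon\Omega\to\mathbb C^d$ a holomorphic map such that, near $0$, $M$ is given by the equation $w=Q(z,\bar z,\bar w)$. Put $$S_0=\{(z,w)\in\mathbb C^{n+d} : (z,0)\in\Omega,\ w=Q(z,0)\}$$ (the Segre variety of $0$), and let $S$ be the connected component containing $0$ of $\{\zeta\in S_0 : (0,\bar\zeta)\in\Omega\}$. Suppose that $M$ is, near $0$, biholomorphically equivalent to a real-algebraic generic submanifold $M'\subset\mathbb C^{n+d}$ of codimension $d$, i.e. there is a biholomorphic map $H\colon U\to V$ between open subsets of $\mathbb C^{n+d}$ with $0\in U$ and $H(M\cap U)=M'\cap V$. Here $M'$ is called real-algebraic if it is contained in a real-algebraic subset of $\mathbb C^{n+d}=\mathbb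 R^{2(n+d)}$ of the same dimension $2n+d$. Then for all indices $i_1,\dots,i_{n+1}\in\{1,\dots,d\}$ and all multi-indices $\alpha_1,\dots,\alpha_{n+1}\in\mathbb N^n$, the $n+1$ functions $$\zeta\mapsto Q^{i_s}_{z^{\alpha_s}}(0,\bar\zeta)=\frac{\partial^{|\alpha_s|}Q^{i_s}}{\partial z^{\alpha_s}}(0,\bar\zeta),\qquad s=1,\dots,n+1,\quad \zeta\in S,$$ are algebraically dependent: there is a nonzero polynomial $P\in\mathbb C[x_1,\dots,x_{n+1}]$ with $$P\big(Q^{i_1}_{z^{\alpha_1}}(0,\bar\zeta),\dots,Q^{i_{n+1}}_{z^{\alpha_{n+1}}}(0,\bar\zeta)\big)=0\qquad\text{for all }\zeta\in S .$$ -/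

import Mathlib

open Filter Topology

/-- The complex space `ℂ^{n+d}`, with points `Z = (z, w)`, `z ∈ ℂ^n`, `w ∈ ℂ^d`. -/
abbrev CSpace (n d : ℕ) : Type := (Fin n → ℂ) × (Fin d → ℂ)

/-- `M` is a (locally closed) real-analytic generic submanifold of real codimension `d` in the
complex vector space `E`: near each of its points `p` it is the zero set of an `ℝ^d`-valued
real-analytic function `ρ` with surjective differential at `p`, and the tangent space
`T_p M = ker dρ(p)` satisfies `T_p M + i T_p M = E`. -/
def IsGenericSubmanifold {E : Type*} [NormedAddCommGroup E] [NormedSpace ℝ E] [NormedSpace ℂ E]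
    (d : ℕ) (M : Set E) : Prop :=
  ∀ p ∈ M, ∃ ρ : E → Fin d → ℝ,
    AnalyticAt ℝ ρ p ∧
    (∀ᶠ Z in 𝓝 p, Z ∈ M ↔ ρ Z = 0) ∧
    Function.Surjective (fderiv ℝ ρ p) ∧
    ∀ v : E, ∃ a b : E, fderiv ℝ ρ p a = 0 ∧ fderiv ℝ ρ p b = 0 ∧ v = a + Complex.I • b

/-- Indices of the `2(n+d)` real coordinates on `ℂ^{n+d}`: real parts, then imaginary parts. -/
abbrev RealIdx (n d : ℕ) : Type := (Fin n ⊕ Fin d) ⊕ (Fin n ⊕ Fin d)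

/-- The identification `ℂ^{n+d} = ℝ^{2(n+d)}` by real and imaginary parts. -/
def realCoords {n d : ℕ} (Z : CSpace n d) : RealIdx n d → ℝ :=
  Sum.elim (fun k => (Sum.elim Z.1 Z.2 k).re) (fun k => (Sum.elim Z.1 Z.2 k).im)

/-- The dimension of a subset of `ℝ^σ` in the sense of real algebraic geometry: the Krull dimension
of its ring of polynomial functions. -/
noncomputable def realAlgDim {σ : Type*} (A : Set (σ → ℝ)) : WithBot ℕ∞ :=
  ringKrullDim (MvPolynomial σ ℝ ⧸ MvPolynomial.vanishingIdeal ℝ A)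

/-- `M` is a real-algebraic generic submanifold of codimension `d` in `ℂ^{n+d}`: a real-analytic
generic submanifold of codimension `d` contained in a real-algebraic subset (the common zero set of
real polynomials in the real and imaginary parts of the coordinates) of the same dimension
`2(n+d) - d = 2n+d`. -/
def IsRealAlgebraicGenericSubmanifold {n d : ℕ} (M : Set (CSpace n d)) : Prop :=
  IsGenericSubmanifold d M ∧
  ∃ I : Ideal (MvPolynomial (RealIdx n d) ℝ),
    (∀ Z ∈ M, realCoords Z ∈ MvPolynomial.zeroLocus ℝ I) ∧
    realAlgDim (MvPolynomial.zeroLocus ℝ I) = ((2 * n + d : ℕ) : WithBot ℕ∞)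

/-- `M` is, near its point `p`, biholomorphically equivalent to `M'`: there is a biholomorphic map
`H` from an open neighbourhood of `p` onto an open set, with `H(M ∩ source) = M' ∩ target`. -/
def BiholomorphicallyEquivalentAt {E : Type*} [NormedAddCommGroup E] [NormedSpace ℂ E]
    (M : Set E) (p : E) (M' : Set E) : Prop :=
  ∃ H : OpenPartialHomeomorph E E,
    p ∈ H.source ∧
    AnalyticOnNhd ℂ H H.source ∧ AnalyticOnNhd ℂ H.symm H.target ∧
    H '' (M ∩ H.source) = M' ∩ H.target

/-- The partial derivative `∂f/∂z_j` of a function on `ℂ^n`. -/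
noncomputable def partialDeriv {n : ℕ} (j : Fin n) (f : (Fin n → ℂ) → ℂ) : (Fin n → ℂ) → ℂ :=
  fun z => fderiv ℂ f z (Pi.single j 1)

/-- The iterated partial derivative `f_{z^α} = ∂^{|α|} f / ∂z_1^{α_1} ⋯ ∂z_n^{α_n}`. -/
noncomputable def multiDeriv {n : ℕ} (α : Fin n → ℕ) (f : (Fin n → ℂ) → ℂ) : (Fin n → ℂ) → ℂ :=
  (List.finRange n).foldr (fun j g => (partialDeriv j)^[α j] g) f

/-- The Segre variety `S_ζ = {(z, w) : w = Q(z, ζ̄)}` associated to a function `Q(z, ζ̄)` with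
domain `Ω`. -/
def segreVariety {n d : ℕ} (Ω : Set ((Fin n → ℂ) × CSpace n d))
    (Q : (Fin n → ℂ) × CSpace n d → Fin d → ℂ) (ζ : CSpace n d) : Set (CSpace n d) :=
  {Z | (Z.1, star ζ) ∈ Ω ∧ Z.2 = Q (Z.1, star ζ)}

/-- The connected component through `0` of the part of `S_0` consisting of those `ζ` for which
`(0, ζ̄)` lies in the domain `Ω` of `Q`, so that the derivatives of `Q` at `(0, ζ̄)` make sense. -/
def segreComponent {n d : ℕ} (Ω : Set ((Fin n → ℂ) × CSpace n d))
    (Q : (Fin n → ℂ) × CSpace n d → Fin d → ℂ) : Set (CSpace n d) :=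
  connectedComponentIn {ζ | ζ ∈ segreVariety Ω Q 0 ∧ ((0 : Fin n → ℂ), star ζ) ∈ Ω} 0

/-! Complexify: let `ζ = (χ, τ)` be independent of `z`, so that `(z, ζ)` parametrizes the
complexification `w = Q(z, ζ)` of `M`. In the domain `O` of analytic germs at `0` in `(z, ζ)`, let
`A` be the subalgebra of germs `f(z, Q(z, ζ))`, let `Z' = H(z, Q(z, ζ))` (entries in `A`), and let
`ζ'` be the conjugate of `H` evaluated at `ζ`. The image of `M` under `Z ↦ (z, Z̄)` is a set of
uniqueness, so the real equations satisfied by `H(M)` become identities in `O`. Hence all of `Z',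
ζ'` are algebraic over at most `2n + d = (n + d) + n` of their polynomial combinations
(`exists_transcendence_generators`), while `Z'` and `ζ'` are each algebraically independent families
of size `n + d`. So `Z'` has transcendence degree at most `n` over `ζ'`, and conversely.

Let `T` be the algebraic closure in `O` of `A[ζ']`. The point is that `T` is stable under every
`∂/∂z_j`. These derivations kill `ζ'`, so the differentials of `Z'` are combinations over `Frac T`
of those of only `n` functions `y_b`. Since `H` is invertible, `dz_l` is an `A`-combination of the
`dZ'_i`; hence the `n × n` matrix `(∂y_b/∂z_j)` has an inverse over `Frac T`, and its entries lie in
`T` (`derivation_mem_algebraicOver`). Stability follows by the chain rule.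

Thus all `z`-derivatives of `Q` lie in `T`, which has transcendence degree at most `n` over `A`
because `Z'` lies in `A`. Any `n + 1` of them satisfy a nontrivial relation whose coefficients are
analytic in `(z, Q(z, ζ))`. The reality of `M` makes `(χ, z, w)` coordinates on the
complexification; specializing to `(z, w) = 0` along a line, after removing a power of the
parameter, leaves a nonzero constant-coefficient relation along the Segre variety near `0`
(`exists_specialized_relation`). The identity theorem extends it to the connected component. -/

/-! ### Krull dimension and Noether normalization -/

/-- An injective integral ring extension does not lower the Krull dimension. -/
theorem ringKrullDim_le_of_isIntegral {R S : Type*} [CommRing R] [CommRing S] [Algebra R S]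
    [Algebra.IsIntegral R S] (hinj : Function.Injective (algebraMap R S)) :
    ringKrullDim R ≤ ringKrullDim S := by
  refine iSup_le fun l => ?_
  -- Lying over lifts the bottom prime of the chain, starting from `⊥`, whose preimage is the zero
  -- kernel; going up then lifts the rest.
  obtain ⟨P, -, hP, hPc⟩ := Ideal.exists_ideal_over_prime_of_isIntegral (S := S)
    l.head.asIdeal ⊥ (by
      rw [← RingHom.ker_eq_comap_bot, (RingHom.injective_iff_ker_eq_bot _).1 hinj]; exact bot_le)
  have : P.LiesOver l.head.asIdeal := ⟨hPc.symm⟩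
  obtain ⟨L, hL, -, -⟩ := Ideal.exists_ltSeries_of_hasGoingUp l P
  rw [← hL]
  exact le_iSup (fun L : LTSeries (PrimeSpectrum S) => (L.length : WithBot ℕ∞)) L

/-- A finitely generated algebra of Krull dimension `m` is integral over the subalgebra generated by
at most `m` elements. -/
theorem exists_isIntegral_adjoin_range_of_ringKrullDim {k R : Type*} [Field k] [CommRing R]
    [Algebra k R] [Algebra.FiniteType k R] {m : ℕ} (h : ringKrullDim R = (m : WithBot ℕ∞)) :
    ∃ s ≤ m, ∃ t : Fin s → R, ∀ x : R, IsIntegral (Algebra.adjoin k (Set.range t)) x := by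
  have : Nontrivial R := by
    by_contra hR
    rw [not_nontrivial_iff_subsingleton] at hR
    rw [ringKrullDim_eq_bot_of_subsingleton] at h
    exact absurd h.symm (WithBot.coe_ne_bot)
  -- Noether normalization; the number `s` of variables is at most `m` because the polynomial ring,
  -- of dimension `s`, embeds integrally.
  obtain ⟨s, g, hg, hint⟩ := exists_integral_inj_algHom_of_fg k R
  refine ⟨s, ?_, fun i => g (MvPolynomial.X i), fun x => ?_⟩
  · algebraize [g.toRingHom]
    have : Algebra.IsIntegral (MvPolynomial (Fin s) k) R := ⟨hint⟩
    have hle := ringKrullDim_le_of_isIntegral (R := MvPolynomial (Fin s) k) (S := R) hg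
    rw [h, MvPolynomial.ringKrullDim_of_isNoetherianRing, ringKrullDim_eq_zero_of_field] at hle
    simpa using hle
  · obtain ⟨p, hp, hpx⟩ := hint x
    have hr : ∀ q, g q ∈ Algebra.adjoin k (Set.range fun i => g (MvPolynomial.X i)) := by
      intro q
      rw [Algebra.adjoin_range_eq_range_aeval]
      exact ⟨q, (DFunLike.congr_fun (MvPolynomial.aeval_unique g) q).symm⟩
    let g' : MvPolynomial (Fin s) k →+* Algebra.adjoin k (Set.range fun i => g (MvPolynomial.X i)) :=
      g.toRingHom.codRestrict _ hr
    refine ⟨p.map g', hp.map _, ?_⟩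
    rw [Polynomial.eval₂_map]
    exact hpx

/-! ### Derivations and algebraic elements -/

section Derivation

variable {k O M : Type*} [CommRing k] [CommRing O] [Algebra k O] [AddCommGroup M] [Module O M]
  [Module k M]

/-- A derivation mapping the generators of a subalgebra into a module over a ring `T` containing
these generators maps the subalgebra into that module. -/
theorem Derivation.mem_of_mem_adjoin (D : Derivation k O M) (T : Subalgebra k O)
    (W : Submodule T M) {s : Set O} (hs : s ⊆ T) (hD : ∀ x ∈ s, D x ∈ W) {x : O}
    (hx : x ∈ Algebra.adjoin k s) : D x ∈ W := by
  have key : x ∈ T ∧ D x ∈ W := by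
    induction hx using Algebra.adjoin_induction with
    | mem x hx => exact ⟨hs hx, hD x hx⟩
    | algebraMap r => exact ⟨T.algebraMap_mem r, by simp⟩
    | add x y _ _ hx hy => exact ⟨T.add_mem hx.1 hy.1, by rw [map_add]; exact W.add_mem hx.2 hy.2⟩
    | mul x y _ _ hx hy =>
      refine ⟨T.mul_mem hx.1 hy.1, ?_⟩
      rw [D.leibniz]
      exact W.add_mem (W.smul_mem ⟨x, hx.1⟩ hy.2) (W.smul_mem ⟨y, hy.1⟩ hx.2)
  exact key.2

/-- A derivation mapping a subalgebra `S` into a saturated module over a ring `T ⊇ S` also maps the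
elements of `T` that are algebraic over `S` into that module. -/
theorem Derivation.mem_of_isAlgebraic [IsDomain O] [CharZero O] (D : Derivation k O M)
    (S T : Subalgebra k O) (hST : S ≤ T)
    (W : Submodule T M) (hW : ∀ e : T, e ≠ 0 → ∀ v : M, e • v ∈ W → v ∈ W)
    (hD : ∀ x ∈ S, D x ∈ W) {x : O} (hxT : x ∈ T) (hx : IsAlgebraic S x) : D x ∈ W := by
  classical
  -- An annihilating polynomial of minimal degree: in characteristic zero its derivative is nonzero
  -- of smaller degree, so it cannot vanish at `x`.
  have hex : ∃ m, ∃ p : Polynomial S, p ≠ 0 ∧ Polynomial.aeval x p = 0 ∧ p.natDegree = m := by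
    obtain ⟨p, hp, hpx⟩ := hx
    exact ⟨_, p, hp, hpx, rfl⟩
  obtain ⟨p, hp, hpx, hdeg⟩ := Nat.find_spec hex
  have hpT : ∀ q : Polynomial S, Polynomial.aeval x q ∈ T := by
    intro q
    induction q using Polynomial.induction_on' with
    | add p q hp hq => rw [map_add]; exact T.add_mem hp hq
    | monomial i a =>
      rw [Polynomial.aeval_monomial]
      exact T.mul_mem (hST a.2) (T.pow_mem hxT i)
  have hinj : Function.Injective (algebraMap S O) := Subtype.val_injective
  have hne : Polynomial.aeval x (Polynomial.derivative p) ≠ 0 := by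
    intro h0
    have hpos : 0 < p.natDegree := by
      by_contra hz
      obtain ⟨c, rfl⟩ := Polynomial.natDegree_eq_zero.1 (Nat.eq_zero_of_not_pos hz)
      rw [Polynomial.aeval_C] at hpx
      exact hp (by rw [hinj (hpx.trans (map_zero _).symm), Polynomial.C_0])
    have hlt := Polynomial.natDegree_derivative_lt hpos.ne'
    have hd0 : Polynomial.derivative p ≠ 0 := fun h => by
      have := Polynomial.derivative_eq_zero.1 h
      omega
    exact Nat.find_min hex (hdeg ▸ hlt) ⟨_, hd0, h0, rfl⟩
  -- Modulo `W` the coefficients behave as constants, so `D (q(x))` is congruent to `q'(x) • D x`.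
  have key : ∀ q : Polynomial S,
      D (Polynomial.aeval x q) - Polynomial.aeval x (Polynomial.derivative q) • D x ∈ W := by
    intro q
    induction q using Polynomial.induction_on' with
    | add p q hp hq =>
      have := W.add_mem hp hq
      simp only [map_add, add_smul] at this ⊢
      convert this using 1; abel
    | monomial i a =>
      have h1 : (x ^ i) • D (a : O) ∈ W := W.smul_mem ⟨x ^ i, T.pow_mem hxT i⟩ (hD _ a.2)
      convert h1 using 1
      rw [Polynomial.derivative_monomial, Polynomial.aeval_monomial, Polynomial.aeval_monomial,
        D.leibniz, D.leibniz_pow]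
      have : algebraMap S O (a * (i : S)) = (a : O) * (i : O) := by
        rw [map_mul]; exact congrArg (fun c : O => (a : O) * c) (_root_.map_natCast (algebraMap S O) i)
      rw [this]
      have h2 : (algebraMap S O) a = (a : O) := rfl
      rw [h2, ← Nat.cast_smul_eq_nsmul O, smul_smul, smul_smul]
      abel
  -- Since `p(x) = 0`, this says `p'(x) • D x ∈ W`; saturation cancels the nonzero factor `p'(x)`.
  have h := key p
  rw [hpx, map_zero, zero_sub] at h
  exact hW ⟨_, hpT _⟩ (fun h0 => hne (congrArg Subtype.val h0)) _ (by
    simpa only [neg_neg] using! W.neg_mem h)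

end Derivation

/-! ### Algebraic closure of a subalgebra, exchange and transcendence degree -/

section TranscendenceDegree

variable {R O : Type*} [CommRing R] [CommRing O] [Algebra R O]

/-- Algebraicity over a subalgebra passes to a larger subalgebra. -/
theorem IsAlgebraic.of_subalgebra_subset {R' : Type*} [CommRing R'] [Algebra R' O]
    {S : Subalgebra R O} {S' : Subalgebra R' O} (h : (S : Set O) ⊆ S') {x : O}
    (hx : IsAlgebraic S x) : IsAlgebraic S' x := by
  obtain ⟨p, hp, hpx⟩ := hx
  let f : S →+* S' := (S.val : S →+* O).codRestrict S' fun a => h a.2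
  have hf : Function.Injective f := fun a b hab =>
    Subtype.ext (congrArg (fun c : S' => (c : O)) hab)
  refine ⟨p.map f, (Polynomial.map_ne_zero_iff hf).2 hp, ?_⟩
  rw [Polynomial.aeval_def, Polynomial.eval₂_map]
  exact hpx

variable [IsDomain O]

/-- The elements of `O` that are algebraic over the subalgebra `S`. -/
noncomputable def Subalgebra.algClosure (S : Subalgebra R O) : Subalgebra R O :=
  (Subalgebra.algebraicClosure S O).restrictScalars R

theorem Subalgebra.le_algClosure (S : Subalgebra R O) : S ≤ S.algClosure :=
  fun x hx => isAlgebraic_algebraMap (⟨x, hx⟩ : S)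

theorem Subalgebra.algClosure_le_of_le {S S' : Subalgebra R O} (h : S ≤ S'.algClosure) :
    S.algClosure ≤ S'.algClosure := by
  intro x hx
  have hx' : IsAlgebraic S'.algClosure x := hx.of_subalgebra_subset (S' := S'.algClosure) h
  have h2 : IsAlgebraic (Subalgebra.algebraicClosure S' O) x := hx'
  exact h2.restrictScalars S'

/-- A quotient of algebraic elements is algebraic. This is what brings elements of `Frac T` that
happen to lie in `O` back into `T`. -/
theorem Subalgebra.mem_algClosure_of_mul {S : Subalgebra R O} {x y : O} (hx0 : x ≠ 0)
    (hx : x ∈ S.algClosure) (hxy : x * y ∈ S.algClosure) : y ∈ S.algClosure :=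
  IsAlgebraic.of_mul (mem_nonZeroDivisors_of_ne_zero hx0) hx hxy

variable [FaithfulSMul R O]

/-- Exchange: an algebraically independent family inside the algebraic closure of few elements can
be completed to a generating family of that closure, up to algebraicity. -/
theorem AlgebraicIndependent.exists_complement [IsDomain R] {ν : Type*} [Fintype ν] {x : ν → O}
    (hx : AlgebraicIndependent R x) {n s : ℕ} (hs : s ≤ Fintype.card ν + n) (t : Fin s → O)
    (hxt : ∀ k, IsAlgebraic (Algebra.adjoin R (Set.range t)) (x k)) :
    ∃ y : Fin n → O, (∀ i, IsAlgebraic (Algebra.adjoin R (Set.range t)) (y i)) ∧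
      ∀ e : O, IsAlgebraic (Algebra.adjoin R (Set.range t)) e →
        IsAlgebraic (Algebra.adjoin R (Set.range x ∪ Set.range y)) e := by
  have hcl (u : Set O) (e : O) : e ∈ (AlgebraicIndependent.matroid R O).closure u ↔
      IsAlgebraic (Algebra.adjoin R u) e := by
    rw [AlgebraicIndependent.matroid_closure_eq]; rfl
  have hI : (AlgebraicIndependent.matroid R O).Indep (Set.range x) :=
    AlgebraicIndependent.matroid_indep_iff.2 hx.to_subtype_range
  have hsub : Set.range x ⊆ (AlgebraicIndependent.matroid R O).closure (Set.range t) := by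
    rintro _ ⟨k, rfl⟩
    exact (hcl _ _).2 (hxt k)
  -- In the matroid of algebraic independence, extend `x` to a basis `J` of the closure of `t`. Its
  -- size is the rank, at most `s`, so at most `n` elements remain outside `x`.
  obtain ⟨J, hJ, hxJ⟩ := hI.subset_isBasis_of_subset hsub
    (AlgebraicIndependent.matroid_e R O ▸ Set.subset_univ _)
  have hJs : J.encard ≤ s := by
    rw [hJ.encard_eq_eRk, Matroid.eRk_closure_eq]
    refine (Matroid.eRk_le_encard _ _).trans ?_
    rw [← Set.image_univ]
    refine (Set.encard_image_le _ _).trans ?_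
    simp
  have hxc : (Set.range x).encard = Fintype.card ν := by
    rw [← Set.image_univ, hx.injective.encard_image]
    simp
  have hdiff : (J \ Set.range x).encard ≤ n := by
    have h1 := Set.encard_sdiff_add_encard_of_subset hxJ
    rw [hxc] at h1
    have h2 : (J \ Set.range x).encard + (Fintype.card ν : ℕ∞) ≤ n + (Fintype.card ν : ℕ∞) := by
      rw [h1]
      refine hJs.trans ?_
      rw [add_comm]
      exact_mod_cast hs
    exact (ENat.add_le_add_iff_right (ENat.natCast_ne_top _)).1 h2
  have hfin : (J \ Set.range x).Finite := Set.finite_of_encard_le_coe hdiff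
  obtain ⟨y, hy1, hy2⟩ : ∃ y : Fin n → O, J \ Set.range x ⊆ Set.range y ∧
      ∀ i, y i ∈ insert 0 (J \ Set.range x) := by
    have hcard : hfin.toFinset.card ≤ n := by
      rw [hfin.encard_eq_coe_toFinset_card] at hdiff
      exact_mod_cast hdiff
    let e := hfin.toFinset.equivFin
    -- There may be fewer than `n` new elements; the list is padded with `0`, which is algebraic
    -- over anything.
    refine ⟨fun i => if h : (i : ℕ) < hfin.toFinset.card then (e.symm ⟨i, h⟩ : O) else 0, ?_, ?_⟩
    · intro z hz
      refine ⟨Fin.castLE hcard (e ⟨z, hfin.mem_toFinset.2 hz⟩), ?_⟩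
      simp
    · intro i
      by_cases h : (i : ℕ) < hfin.toFinset.card
      · simp only [h, dite_true]
        exact Set.mem_insert_of_mem _ (hfin.mem_toFinset.1 (e.symm ⟨i, h⟩).2)
      · simp [h]
  refine ⟨y, fun i => ?_, fun e he => ?_⟩
  · rcases hy2 i with h | h
    · rw [h]; exact isAlgebraic_zero
    · exact (hcl _ _).1 (hJ.subset h.1)
  · have hJe : e ∈ (AlgebraicIndependent.matroid R O).closure J := by
      rw [hJ.closure_eq_closure, Matroid.closure_closure]
      exact (hcl _ _).2 he
    refine (hcl _ _).1 ((AlgebraicIndependent.matroid R O).closure_subset_closure ?_ hJe)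
    intro z hz
    by_cases hzx : z ∈ Set.range x
    · exact Or.inl hzx
    · exact Or.inr (hy1 ⟨hz, hzx⟩)

/-- More than `n` elements algebraic over `n` elements are algebraically dependent. -/
theorem not_algebraicIndependent_of_isAlgebraic [IsDomain R] {n : ℕ} (y : Fin n → O)
    (f : Fin (n + 1) → O)
    (hf : ∀ s, IsAlgebraic (Algebra.adjoin R (Set.range y)) (f s)) :
    ¬ AlgebraicIndependent R f := by
  intro hind
  have hI : (AlgebraicIndependent.matroid R O).Indep (Set.range f) :=
    AlgebraicIndependent.matroid_indep_iff.2 hind.to_subtype_range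
  have hsub : Set.range f ⊆ (AlgebraicIndependent.matroid R O).closure (Set.range y) := by
    rintro _ ⟨k, rfl⟩
    rw [AlgebraicIndependent.matroid_closure_eq]
    exact hf k
  have h1 : (Set.range f).encard ≤ n := by
    rw [← hI.eRk_eq_encard]
    refine ((AlgebraicIndependent.matroid R O).eRk_mono hsub).trans ?_
    rw [Matroid.eRk_closure_eq]
    refine (Matroid.eRk_le_encard _ _).trans ?_
    rw [← Set.image_univ]
    refine (Set.encard_image_le _ _).trans ?_
    simp
  rw [← Set.image_univ, hind.injective.encard_image] at h1
  simp only [Set.encard_univ, ENat.card_eq_coe_fintype_card, Fintype.card_fin] at h1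
  have : n + 1 ≤ n := by exact_mod_cast h1
  omega

end TranscendenceDegree

/-! ### The algebraic core: stability under derivations -/

/-- If `N * X` is diagonal with nonzero diagonal, and a subalgebra closed under division contains
the entries of `N` and of the diagonal, then it contains the entries of `X`. -/
theorem Matrix.entries_mem_of_mul_eq_diagonal {R O : Type*} [CommRing R] [CommRing O] [IsDomain O]
    [Algebra R O] {n : ℕ} (T : Subalgebra R O)
    (hT : ∀ x y : O, x ≠ 0 → x ∈ T → x * y ∈ T → y ∈ T)
    (N : Matrix (Fin n) (Fin n) T) (X : Matrix (Fin n) (Fin n) O) (e : Fin n → T)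
    (he : ∀ i, e i ≠ 0) (h : N.map T.val * X = Matrix.diagonal fun i => (e i : O)) (i j : Fin n) :
    X i j ∈ T := by
  have hdet : (N.map T.val).det ≠ 0 := by
    intro h0
    have h1 := congrArg Matrix.det h
    rw [Matrix.det_mul, h0, zero_mul, Matrix.det_diagonal] at h1
    exact Finset.prod_ne_zero_iff.2 (fun i _ => fun h => he i (Subtype.ext h)) h1.symm
  have hdetT : (N.map T.val).det = (N.det : O) := (AlgHom.map_det T.val N).symm
  have hadj : (N.map T.val).adjugate = N.adjugate.map T.val := (AlgHom.map_adjugate T.val N).symm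
  refine hT _ _ hdet (by rw [hdetT]; exact N.det.2) ?_
  -- Cramer's rule: multiplying by the adjugate puts `det N • X` in `T`, and `T` is closed under
  -- division.
  have h2 : (N.map T.val).det • X = (N.adjugate * Matrix.diagonal e).map T.val := by
    have h3 : ((Matrix.diagonal e).map T.val) = Matrix.diagonal fun i => (e i : O) := by
      rw [Matrix.diagonal_map (map_zero _)]; rfl
    rw [Matrix.map_mul, h3, ← h, ← hadj, ← Matrix.mul_assoc, Matrix.adjugate_mul, Matrix.smul_mul,
      Matrix.one_mul]
  have h4 := congrFun (congrFun h2 i) j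
  rw [Matrix.smul_apply, smul_eq_mul] at h4
  rw [h4]
  exact ((N.adjugate * Matrix.diagonal e) i j).2

/-- Mediates between two base rings: generation is over `k`, whereas `B` is a subalgebra over `A`.
-/
theorem mem_of_mem_adjoin_of_subset {k O : Type*} [CommRing k] [CommRing O] [Algebra k O] {A : Subalgebra k O} (B : Subalgebra A O)
    (hAB : ∀ x ∈ A, x ∈ B) {s : Set O} (hs : s ⊆ B) {x : O} (hx : x ∈ Algebra.adjoin k s) :
    x ∈ B := by
  induction hx using Algebra.adjoin_induction with
  | mem x hx => exact hs hx
  | algebraMap r => exact hAB _ (A.algebraMap_mem r)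
  | add x y _ _ hx hy => exact B.add_mem hx hy
  | mul x y _ _ hx hy => exact B.mul_mem hx hy

section AlgebraicDerivation

variable {k O : Type*} [Field k] [CommRing O] [IsDomain O] [Algebra k O]

/-- The vectors of the form `∑ b, c b • v b` with coefficients `c b` in the fraction field of `T`. -/
def fractionSpan (T : Subalgebra k O) {n m : ℕ} (v : Fin m → Fin n → O) :
    Submodule T (Fin n → O) where
  carrier := {u | ∃ e : T, e ≠ 0 ∧ ∃ c : Fin m → T, e • u = ∑ b, c b • v b}
  zero_mem' := ⟨1, one_ne_zero, 0, by simp⟩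
  add_mem' := by
    rintro u u' ⟨e, he, c, hc⟩ ⟨e', he', c', hc'⟩
    refine ⟨e * e', mul_ne_zero he he', fun b => e' * c b + e * c' b, ?_⟩
    simp only [add_smul, Finset.sum_add_distrib, mul_smul, ← Finset.smul_sum, ← hc, ← hc', smul_add]
    rw [smul_comm e' e u]
  smul_mem' := by
    rintro a u ⟨e, he, c, hc⟩
    refine ⟨e, he, fun b => a * c b, ?_⟩
    simp only [mul_smul, ← Finset.smul_sum, ← hc]
    rw [smul_comm]

/-- Denominators multiply. This is the saturation that `Derivation.mem_of_isAlgebraic` asks for. -/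
theorem mem_fractionSpan_of_smul {T : Subalgebra k O} {n m : ℕ} {v : Fin m → Fin n → O} (e : T)
    (he : e ≠ 0) (u : Fin n → O) (h : e • u ∈ fractionSpan T v) : u ∈ fractionSpan T v := by
  obtain ⟨e', he', c, hc⟩ := h
  exact ⟨e' * e, mul_ne_zero he' he, c, by rw [mul_smul, hc]⟩

variable {n s : ℕ} {ν : Type*} (D : Derivation k O (Fin n → O)) (A : Subalgebra k O)
  (Z' ζ' : ν → O)

/-- The elements algebraic over the algebra generated by `A` and the functions `ζ'`. -/
noncomputable def algebraicOver : Subalgebra k O :=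
  (Algebra.adjoin k ((A : Set O) ∪ Set.range ζ')).algClosure

theorem le_algebraicOver : A ≤ algebraicOver A ζ' :=
  fun _ hx => Subalgebra.le_algClosure _ (Algebra.subset_adjoin (Or.inl hx))

theorem mem_algebraicOver (i : ν) : ζ' i ∈ algebraicOver A ζ' :=
  Subalgebra.le_algClosure _ (Algebra.subset_adjoin (Or.inr ⟨i, rfl⟩))

theorem adjoin_le_algebraicOver (hZ'A : ∀ i, Z' i ∈ A) :
    Algebra.adjoin k (Set.range Z' ∪ Set.range ζ') ≤ algebraicOver A ζ' := by
  refine Algebra.adjoin_le ?_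
  rintro _ (⟨i, rfl⟩ | ⟨i, rfl⟩)
  · exact le_algebraicOver A ζ' (hZ'A i)
  · exact mem_algebraicOver A ζ' i

variable {A Z' ζ'}

/-- The vectors with all entries in the subalgebra `T`. -/
def subalgebraVectors (T : Subalgebra k O) (n : ℕ) : Submodule T (Fin n → O) where
  carrier := {u | ∀ j, u j ∈ T}
  zero_mem' := fun _ => T.zero_mem
  add_mem' := fun hu hv j => T.add_mem (hu j) (hv j)
  smul_mem' := fun a _ hu j => T.mul_mem a.2 (hu j)

/-- Reduces stability of `T` to the generators in `A`: the `ζ'` are constants for `D`, and vectors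
with entries in `T` form a saturated module because `T` is closed under division. Iteration then
handles derivatives of any order. -/
theorem derivation_mem_algebraicOver_of_mem [CharZero O] (hζ'D : ∀ i, D (ζ' i) = 0)
    (hA : ∀ a ∈ A, ∀ j, D a j ∈ algebraicOver A ζ') {x : O} (hx : x ∈ algebraicOver A ζ')
    (j : Fin n) : D x j ∈ algebraicOver A ζ' := by
  set T := algebraicOver A ζ' with hT
  let W := subalgebraVectors T n
  have hgen : (A : Set O) ∪ Set.range ζ' ⊆ T := by
    rintro _ (hx | ⟨i, rfl⟩)
    · exact le_algebraicOver A ζ' hx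
    · exact mem_algebraicOver A ζ' i
  have key : D x ∈ W := by
    refine D.mem_of_isAlgebraic (Algebra.adjoin k ((A : Set O) ∪ Set.range ζ')) T
      (Algebra.adjoin_le hgen) W ?_ ?_ hx hx
    · intro e he v hv j
      exact Subalgebra.mem_algClosure_of_mul (fun h0 => he (Subtype.ext h0)) e.2 (hv j)
    · intro y hy
      refine D.mem_of_mem_adjoin T W hgen ?_ hy
      rintro _ (hx | ⟨i, rfl⟩)
      · exact fun j => hA _ hx j
      · rw [hζ'D]; exact W.zero_mem
  exact key j

variable [Fintype ν]

/-- A function whose differential is an `A`-combination of those of the `Z'` has derivatives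
algebraic over `A` and `ζ'`, provided that `Z'` and `ζ'` together have transcendence degree at most
`n` over `ζ'`, and that this also applies to functions `z` dual to the derivations. -/
theorem derivation_mem_algebraicOver [CharZero O] (hZ'A : ∀ i, Z' i ∈ A) (hζ'D : ∀ i, D (ζ' i) = 0)
    (hζ' : AlgebraicIndependent k ζ') (hs : s ≤ Fintype.card ν + n) (t : Fin s → O)
    (ht : ∀ i, t i ∈ Algebra.adjoin k (Set.range Z' ∪ Set.range ζ'))
    (hZ't : ∀ i, IsAlgebraic (Algebra.adjoin k (Set.range t)) (Z' i))
    (hζ't : ∀ i, IsAlgebraic (Algebra.adjoin k (Set.range t)) (ζ' i))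
    (z : Fin n → O) (hz : ∀ l, D (z l) = Pi.single l 1)
    (hzJ : ∀ l, ∃ J : ν → O, (∀ i, J i ∈ A) ∧ D (z l) = ∑ i, J i • D (Z' i))
    (w : O) (hwJ : ∃ J : ν → O, (∀ i, J i ∈ A) ∧ D w = ∑ i, J i • D (Z' i)) (j : Fin n) :
    D w j ∈ algebraicOver A ζ' := by
  -- `ζ'` already accounts for `card ν` of the transcendence degree, so `n` further functions `y`
  -- suffice.
  obtain ⟨y, hy, hgen⟩ := hζ'.exists_complement hs t hζ't
  set T := algebraicOver A ζ' with hT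
  have htT : Algebra.adjoin k (Set.range t) ≤ T := by
    refine Algebra.adjoin_le ?_
    rintro _ ⟨i, rfl⟩
    exact adjoin_le_algebraicOver A Z' ζ' hZ'A (ht i)
  have hyT : ∀ i, y i ∈ T := fun i => Subalgebra.algClosure_le_of_le htT (hy i)
  have hdiv : ∀ x y : O, x ≠ 0 → x ∈ T → x * y ∈ T → y ∈ T :=
    fun x y hx hxT hxy => Subalgebra.mem_algClosure_of_mul hx hxT hxy
  let W := fractionSpan T fun b => D (y b)
  have hgenT : Set.range ζ' ∪ Set.range y ⊆ T := by
    rintro _ (⟨i, rfl⟩ | ⟨i, rfl⟩)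
    · exact mem_algebraicOver A ζ' i
    · exact hyT i
  -- Each `Z' i` is algebraic over `k[ζ', y]` and `D` kills `ζ'`, so only the `D (y b)` are needed,
  -- with coefficients in `Frac T`.
  have hZ'W : ∀ i, D (Z' i) ∈ W := by
    intro i
    refine D.mem_of_isAlgebraic (Algebra.adjoin k (Set.range ζ' ∪ Set.range y)) T
      (Algebra.adjoin_le hgenT) W mem_fractionSpan_of_smul ?_ (le_algebraicOver A ζ' (hZ'A i))
      (hgen _ (hZ't i))
    intro x hx
    refine D.mem_of_mem_adjoin T W hgenT ?_ hx
    rintro _ (⟨i, rfl⟩ | ⟨i, rfl⟩)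
    · rw [hζ'D]; exact W.zero_mem
    · refine ⟨1, one_ne_zero, Pi.single i 1, ?_⟩
      rw [one_smul, Finset.sum_eq_single i]
      · simp
      · intro b _ hb
        simp [hb]
      · simp
  have hJW : ∀ u : O, (∃ J : ν → O, (∀ i, J i ∈ A) ∧ D u = ∑ i, J i • D (Z' i)) → D u ∈ W := by
    rintro u ⟨J, hJ, hu⟩
    rw [hu]
    exact W.sum_mem fun i _ => W.smul_mem ⟨J i, le_algebraicOver A ζ' (hJ i)⟩ (hZ'W i)
  choose e he c hc using fun l => hJW (z l) (hzJ l)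
  -- Expanding `D (z l)`, the `l`-th unit vector, in the `D (y b)` gives `c * (D y) = diagonal e`.
  -- The matrices are square because the number of `y` equals the number of derivations.
  have hX : ∀ b j, D (y b) j ∈ T := by
    intro b j
    refine Matrix.entries_mem_of_mul_eq_diagonal T hdiv (Matrix.of c)
      (Matrix.of fun b j => D (y b) j) e he ?_ b j
    ext l j
    have h := congrFun (hc l) j
    rw [hz] at h
    simp only [Finset.sum_apply, Pi.smul_apply, Subalgebra.smul_def, smul_eq_mul] at h
    rw [Matrix.mul_apply]
    simp only [Matrix.map_apply, Matrix.of_apply, Subalgebra.coe_val]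
    rw [← h, Matrix.diagonal_apply, Pi.single_apply]
    simp [eq_comm]
  obtain ⟨e, he, c, hc⟩ := hJW w hwJ
  have h := congrFun hc j
  simp only [Finset.sum_apply, Pi.smul_apply, Subalgebra.smul_def, smul_eq_mul] at h
  refine hdiv e _ (fun h0 => he (Subtype.ext h0)) e.2 ?_
  rw [h]
  exact T.sum_mem fun b _ => T.mul_mem (c b).2 (hX b j)

/-- The same count with the roles exchanged: the independent `Z'` are completed by `n` functions `y`
so that `ζ'` becomes algebraic over `k[Z', y]`. As `Z'` lies in `A`, all of `algebraicOver A ζ'` is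
algebraic over `A[y]`. -/
theorem not_algebraicIndependent_algebraicOver (hZ'A : ∀ i, Z' i ∈ A)
    (hZ' : AlgebraicIndependent k Z') (hs : s ≤ Fintype.card ν + n) (t : Fin s → O)
    (hZ't : ∀ i, IsAlgebraic (Algebra.adjoin k (Set.range t)) (Z' i))
    (hζ't : ∀ i, IsAlgebraic (Algebra.adjoin k (Set.range t)) (ζ' i))
    (f : Fin (n + 1) → O) (hf : ∀ i, f i ∈ algebraicOver A ζ') : ¬ AlgebraicIndependent A f := by
  obtain ⟨y, -, hgen⟩ := hZ'.exists_complement hs t hZ't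
  refine not_algebraicIndependent_of_isAlgebraic y f fun i => ?_
  have hyB : Set.range y ⊆ Algebra.adjoin A (Set.range y) := Algebra.subset_adjoin
  generalize Algebra.adjoin A (Set.range y) = B at hyB ⊢
  have hAB : ∀ x ∈ A, x ∈ B := fun x hx => B.algebraMap_mem ⟨x, hx⟩
  have h0 : ((Algebra.adjoin k (Set.range Z' ∪ Set.range y) : Subalgebra k O) : Set O) ⊆ B := by
    intro x hx
    refine mem_of_mem_adjoin_of_subset B hAB ?_ hx
    rintro _ (⟨i, rfl⟩ | ⟨i, rfl⟩)
    · exact hAB _ (hZ'A i)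
    · exact hyB ⟨i, rfl⟩
  have h2 : ((Algebra.adjoin k ((A : Set O) ∪ Set.range ζ') : Subalgebra k O) : Set O) ⊆
      B.algClosure := by
    intro x hx
    refine mem_of_mem_adjoin_of_subset B.algClosure (fun x hx => B.le_algClosure (hAB x hx)) ?_ hx
    rintro _ (hx | ⟨i, rfl⟩)
    · exact B.le_algClosure (hAB _ hx)
    · exact (hgen _ (hζ't i)).of_subalgebra_subset h0
  have h3 : IsAlgebraic B.algClosure (f i) := (hf i).of_subalgebra_subset h2
  exact Subalgebra.algClosure_le_of_le le_rfl h3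

end AlgebraicDerivation

/-! ### Transfer of the Krull dimension bound to an image -/

/-- A ring homomorphism from a polynomial ring over a field that kills an ideal whose quotient has
Krull dimension `m` has its image algebraic over at most `m` elements of the image. -/
theorem exists_algebraic_range_of_ringKrullDim {k σ O : Type*} [Field k] [Finite σ] [CommRing O]
    [Nontrivial O] [Algebra k O] (φ : MvPolynomial σ k →ₐ[k] O) (J : Ideal (MvPolynomial σ k))
    (hJ : ∀ p ∈ J, φ p = 0) {m : ℕ}
    (hm : ringKrullDim (MvPolynomial σ k ⧸ J) = (m : WithBot ℕ∞)) :
    ∃ s ≤ m, ∃ t : Fin s → O, (∀ i, t i ∈ φ.range) ∧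
      ∀ p, IsAlgebraic (Algebra.adjoin k (Set.range t)) (φ p) := by
  obtain ⟨s, hs, t, ht⟩ := exists_isIntegral_adjoin_range_of_ringKrullDim (k := k) hm
  let ψ : (MvPolynomial σ k ⧸ J) →ₐ[k] O := Ideal.Quotient.liftₐ J φ hJ
  have hψ : ∀ p, ψ (Ideal.Quotient.mk J p) = φ p := fun p => rfl
  refine ⟨s, hs, fun i => ψ (t i), fun i => ?_, fun p => ?_⟩
  · obtain ⟨q, hq⟩ := Ideal.Quotient.mk_surjective (t i)
    exact ⟨q, (congrArg ψ hq :)⟩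
  · obtain ⟨q, hq, hqx⟩ := ht (Ideal.Quotient.mk J p)
    have hmem : ∀ a : Algebra.adjoin k (Set.range t),
        ψ a ∈ Algebra.adjoin k (Set.range fun i => ψ (t i)) := by
      intro a
      have h1 : ψ a ∈ (Algebra.adjoin k (Set.range t)).map ψ := ⟨a, a.2, rfl⟩
      rw [AlgHom.map_adjoin, ← Set.range_comp] at h1
      exact h1
    let f : Algebra.adjoin k (Set.range t) →+* Algebra.adjoin k (Set.range fun i => ψ (t i)) :=
      ((ψ : (MvPolynomial σ k ⧸ J) →+* O).comp
        ((Algebra.adjoin k (Set.range t)).val : _ →+* MvPolynomial σ k ⧸ J)).codRestrict _ hmem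
    refine ⟨q.map f, (hq.map f).ne_zero, ?_⟩
    rw [Polynomial.aeval_def, Polynomial.eval₂_map, ← hψ]
    have h2 := congrArg ψ hqx
    rw [map_zero] at h2
    rw [← h2]
    exact (Polynomial.hom_eval₂ q _ (ψ : (MvPolynomial σ k ⧸ J) →+* O) _).symm

/-! ### The domain of analytic germs and its derivations -/

section Germ

variable {E : Type*} [NormedAddCommGroup E] [NormedSpace ℂ E]

/-- The algebra of functions analytic at `x`. -/
def analyticFunctionsAt (x : E) : Subalgebra ℂ (E → ℂ) where
  carrier := {f | AnalyticAt ℂ f x}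
  mul_mem' hf hg := AnalyticAt.mul hf hg
  add_mem' hf hg := AnalyticAt.add hf hg
  algebraMap_mem' _ := analyticAt_const

/-- The ideal of functions vanishing near `x`. -/
def eventuallyZeroIdeal (x : E) : Ideal (analyticFunctionsAt x) where
  carrier := {f | ∀ᶠ y in 𝓝 x, (f : E → ℂ) y = 0}
  add_mem' hf hg := by
    filter_upwards [hf, hg] with y h1 h2
    simp [h1, h2]
  zero_mem' := by simp
  smul_mem' c f hf := by
    filter_upwards [hf] with y h1
    simp [h1]

/-- If a product of two analytic functions vanishes near `x`, so does one of the factors. -/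
theorem AnalyticAt.eventually_zero_or_of_mul {x : E} {f g : E → ℂ} (hf : AnalyticAt ℂ f x)
    (hg : AnalyticAt ℂ g x) (h : ∀ᶠ y in 𝓝 x, f y * g y = 0) :
    (∀ᶠ y in 𝓝 x, f y = 0) ∨ ∀ᶠ y in 𝓝 x, g y = 0 := by
  by_contra hcon
  rw [not_or] at hcon
  obtain ⟨r, hr, hball⟩ := Metric.eventually_nhds_iff_ball.1
    ((hf.eventually_analyticAt.and hg.eventually_analyticAt).and h)
  refine hcon.1 ?_
  obtain ⟨p, hp, hgp⟩ : ∃ p ∈ Metric.ball x r, g p ≠ 0 := by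
    by_contra! hz
    exact hcon.2 (Metric.eventually_nhds_iff_ball.2 ⟨r, hr, hz⟩)
  -- Around a point where `g ≠ 0` the other factor vanishes; the identity theorem spreads this over
  -- the ball.
  have hfp : f =ᶠ[𝓝 p] 0 := by
    filter_upwards [(hball p hp).1.2.continuousAt.eventually_ne hgp,
      Metric.isOpen_ball.mem_nhds hp] with y hy hyb
    exact (mul_eq_zero.1 (hball y hyb).2).resolve_right hy
  have hfon : AnalyticOnNhd ℂ f (Metric.ball x r) := fun y hy => (hball y hy).1.1
  have := hfon.eqOn_zero_of_preconnected_of_eventuallyEq_zero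
    (convex_ball x r).isPreconnected hp hfp
  exact Metric.eventually_nhds_iff_ball.2 ⟨r, hr, this⟩

instance (x : E) : (eventuallyZeroIdeal x).IsPrime where
  ne_top' := by
    rw [Ideal.ne_top_iff_one]
    intro h
    have h1 : ∀ᶠ y in 𝓝 x, (1 : E → ℂ) y = 0 := h
    obtain ⟨y, hy⟩ := h1.exists
    exact one_ne_zero hy
  mem_or_mem' {f g} h := AnalyticAt.eventually_zero_or_of_mul f.2 g.2 h

/-- The ring of germs at `x` of complex analytic functions. -/
def AnalyticGerm (x : E) : Type _ := analyticFunctionsAt x ⧸ eventuallyZeroIdeal x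

noncomputable instance (x : E) : CommRing (AnalyticGerm x) :=
  inferInstanceAs (CommRing (analyticFunctionsAt x ⧸ eventuallyZeroIdeal x))

instance (x : E) : IsDomain (AnalyticGerm x) :=
  inferInstanceAs (IsDomain (analyticFunctionsAt x ⧸ eventuallyZeroIdeal x))

noncomputable instance (x : E) : Algebra ℂ (AnalyticGerm x) :=
  inferInstanceAs (Algebra ℂ (analyticFunctionsAt x ⧸ eventuallyZeroIdeal x))

instance (x : E) : CharZero (AnalyticGerm x) :=
  charZero_of_injective_algebraMap (algebraMap ℂ (AnalyticGerm x)).injective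

/-- The germ at `x` of an analytic function. -/
def germ {x : E} (f : E → ℂ) (hf : AnalyticAt ℂ f x) : AnalyticGerm x :=
  Ideal.Quotient.mk _ ⟨f, hf⟩

variable {x : E}

theorem germ_eq_iff {f g : E → ℂ} {hf : AnalyticAt ℂ f x} {hg : AnalyticAt ℂ g x} :
    germ f hf = germ g hg ↔ f =ᶠ[𝓝 x] g := by
  have h : ∀ᶠ y in 𝓝 x, f y - g y = 0 ↔ f y = g y := Eventually.of_forall fun y => sub_eq_zero
  exact Ideal.Quotient.eq.trans (eventually_congr h)

theorem germ_eq_zero_iff {f : E → ℂ} {hf : AnalyticAt ℂ f x} :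
    germ f hf = 0 ↔ ∀ᶠ y in 𝓝 x, f y = 0 :=
  Ideal.Quotient.eq_zero_iff_mem

theorem germ_surjective (a : AnalyticGerm x) : ∃ f, ∃ hf : AnalyticAt ℂ f x, germ f hf = a := by
  obtain ⟨⟨f, hf⟩, rfl⟩ := Ideal.Quotient.mk_surjective a
  exact ⟨f, hf, rfl⟩

theorem germ_add {f g : E → ℂ} (hf : AnalyticAt ℂ f x) (hg : AnalyticAt ℂ g x) :
    germ f hf + germ g hg = germ (fun y => f y + g y) (hf.add hg) := rfl

theorem germ_mul {f g : E → ℂ} (hf : AnalyticAt ℂ f x) (hg : AnalyticAt ℂ g x) :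
    germ f hf * germ g hg = germ (fun y => f y * g y) (hf.mul hg) := rfl

theorem smul_germ (c : ℂ) {f : E → ℂ} (hf : AnalyticAt ℂ f x) :
    c • germ f hf = germ (fun y => c * f y) (analyticAt_const.mul hf) := rfl

/-- The analyticity proof is bundled into the conclusion because the germ on the right cannot be
written without it. -/
theorem aeval_germ {σ : Type*} {F : σ → E → ℂ} (hF : ∀ k, AnalyticAt ℂ (F k) x)
    (p : MvPolynomial σ ℂ) :
    ∃ h : AnalyticAt ℂ (fun y => MvPolynomial.eval (fun k => F k y) p) x,
      MvPolynomial.aeval (fun k => germ (F k) (hF k)) p =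
        germ (fun y => MvPolynomial.eval (fun k => F k y) p) h := by
  induction p using MvPolynomial.induction_on with
  | C c =>
    simp only [MvPolynomial.eval_C, MvPolynomial.aeval_C]
    exact ⟨analyticAt_const, rfl⟩
  | add p q hp hq =>
    obtain ⟨h1, h2⟩ := hp
    obtain ⟨h3, h4⟩ := hq
    simp only [map_add, h2, h4]
    exact ⟨h1.add h3, rfl⟩
  | mul_X p i hp =>
    obtain ⟨h1, h2⟩ := hp
    simp only [map_mul, h2, MvPolynomial.aeval_X, MvPolynomial.eval_X]
    exact ⟨h1.mul (hF i), rfl⟩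

theorem AnalyticAt.fderiv_apply_const {f : E → ℂ} (hf : AnalyticAt ℂ f x) (v : E) :
    AnalyticAt ℂ (fun y => fderiv ℂ f y v) x :=
  ((ContinuousLinearMap.apply ℂ ℂ v).analyticAt _).comp hf.fderiv

theorem germ_sum {ι : Type*} (s : Finset ι) {f : ι → E → ℂ} (hf : ∀ i, AnalyticAt ℂ (f i) x) :
    ∃ h : AnalyticAt ℂ (fun y => ∑ i ∈ s, f i y) x,
      ∑ i ∈ s, germ (f i) (hf i) = germ (fun y => ∑ i ∈ s, f i y) h := by
  classical
  induction s using Finset.induction_on with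
  | empty =>
    simp only [Finset.sum_empty]
    exact ⟨analyticAt_const, rfl⟩
  | insert i s hi ih =>
    obtain ⟨h1, h2⟩ := ih
    simp only [Finset.sum_insert hi, h2]
    exact ⟨(hf i).add h1, rfl⟩

/-- The derivative of a germ in the direction `v`. -/
noncomputable def germDeriv (v : E) (a : AnalyticGerm x) : AnalyticGerm x :=
  germ _ ((germ_surjective a).choose_spec.choose.fderiv_apply_const v)

/-- Independence of the chosen representative: functions that agree near `x` have the same
derivative near `x`. -/
theorem germDeriv_germ (v : E) {f : E → ℂ} (hf : AnalyticAt ℂ f x) :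
    germDeriv v (germ f hf) = germ _ (hf.fderiv_apply_const v) := by
  have h := (germ_surjective (germ f hf)).choose_spec.choose_spec
  rw [germDeriv, germ_eq_iff]
  rw [germ_eq_iff] at h
  filter_upwards [h.fderiv (𝕜 := ℂ)] with y hy
  rw [hy]

/-- Differentiation of germs in the directions `v j`. -/
noncomputable def germDerivation {n : ℕ} (v : Fin n → E) :
    Derivation ℂ (AnalyticGerm x) (Fin n → AnalyticGerm x) :=
  Derivation.mk'
    { toFun := fun a j => germDeriv (v j) a
      map_add' := by
        intro a b
        ext j
        obtain ⟨f, hf, rfl⟩ := germ_surjective a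
        obtain ⟨g, hg, rfl⟩ := germ_surjective b
        rw [Pi.add_apply, germ_add, germDeriv_germ, germDeriv_germ, germDeriv_germ, germ_add,
          germ_eq_iff]
        filter_upwards [hf.eventually_analyticAt, hg.eventually_analyticAt] with y hfy hgy
        rw [fderiv_fun_add hfy.differentiableAt hgy.differentiableAt]
        rfl
      map_smul' := by
        intro c a
        ext j
        obtain ⟨f, hf, rfl⟩ := germ_surjective a
        rw [Pi.smul_apply, smul_germ, germDeriv_germ, germDeriv_germ, RingHom.id_apply, smul_germ,
          germ_eq_iff]
        filter_upwards [hf.eventually_analyticAt] with y hfy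
        rw [fderiv_const_mul hfy.differentiableAt]
        rfl }
    (by
      intro a b
      ext j
      obtain ⟨f, hf, rfl⟩ := germ_surjective a
      obtain ⟨g, hg, rfl⟩ := germ_surjective b
      simp only [LinearMap.coe_mk, AddHom.coe_mk, Pi.add_apply, Pi.smul_apply, smul_eq_mul]
      rw [germ_mul, germDeriv_germ, germDeriv_germ, germDeriv_germ, germ_mul, germ_mul, germ_add,
        germ_eq_iff]
      filter_upwards [hf.eventually_analyticAt, hg.eventually_analyticAt] with y hfy hgy
      rw [fderiv_fun_mul hfy.differentiableAt hgy.differentiableAt]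
      rfl)

theorem germDerivation_germ {n : ℕ} (v : Fin n → E) {f : E → ℂ} (hf : AnalyticAt ℂ f x)
    (j : Fin n) :
    germDerivation v (germ f hf) j = germ _ (hf.fderiv_apply_const (v j)) :=
  germDeriv_germ _ hf

end Germ

/-! ### Conjugation of analytic functions -/

section Conj

variable {E F : Type*} [NormedAddCommGroup E] [NormedSpace ℂ E] [StarAddMonoid E]
  [NormedStarGroup E] [StarModule ℂ E] [NormedAddCommGroup F] [NormedSpace ℂ F] [StarAddMonoid F]
  [NormedStarGroup F] [StarModule ℂ F]

/-- The conjugate `m ↦ star (p (star m))` of a continuous multilinear map. -/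
noncomputable def ContinuousMultilinearMap.starConj {n : ℕ}
    (p : ContinuousMultilinearMap ℂ (fun _ : Fin n => E) F) :
    ContinuousMultilinearMap ℂ (fun _ : Fin n => E) F :=
  MultilinearMap.mkContinuous
    { toFun := fun m => star (p fun i => star (m i))
      map_update_add' := by
        intro _ m i x y
        have h (z : E) : (fun k => star (Function.update m i z k)) =
            Function.update (fun k => star (m k)) i (star z) := by
          ext k
          by_cases hk : k = i
          · subst hk; simp
          · simp [hk]
        simp only [h, star_add, p.map_update_add]
      map_update_smul' := by
        intro _ m i c x
        have h (z : E) : (fun k => star (Function.update m i z k)) =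
            Function.update (fun k => star (m k)) i (star z) := by
          ext k
          by_cases hk : k = i
          · subst hk; simp
          · simp [hk]
        simp only [h, star_smul, p.map_update_smul, star_star] }
    ‖p‖ (by
      intro m
      have h := p.le_opNorm fun i => star (m i)
      simpa only [MultilinearMap.coe_mk, norm_star] using h)

theorem ContinuousMultilinearMap.norm_starConj_le {n : ℕ}
    (p : ContinuousMultilinearMap ℂ (fun _ : Fin n => E) F) : ‖p.starConj‖ ≤ ‖p‖ :=
  MultilinearMap.mkContinuous_norm_le _ (norm_nonneg _) _

/-- The conjugate `y ↦ star (f (star y))` of a complex analytic function is analytic. -/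
theorem AnalyticAt.star_star {f : E → F} {x : E} (hf : AnalyticAt ℂ f (star x)) :
    AnalyticAt ℂ (fun y => star (f (star y))) x := by
  obtain ⟨p, r, hp⟩ := hf
  -- The power series is conjugated term by term; norms do not grow, so the radius of convergence
  -- does not shrink.
  refine ⟨fun n => (p n).starConj, r, ?_, hp.r_pos, ?_⟩
  · refine hp.r_le.trans ?_
    exact FormalMultilinearSeries.radius_le_of_le fun n => (p n).norm_starConj_le
  · intro y hy
    have hy' : star y ∈ Metric.eball (0 : E) r := by
      simpa [Metric.mem_eball, edist_zero_right, enorm_eq_nnnorm] using hy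
    have h := (hp.hasSum hy').star
    simpa only [star_add] using! h

end Conj

/-! ### Coordinates and the chain rule for germs -/

section Coordinates

variable {n d : ℕ}

/-- The coordinate functions of `ℂ^{n+d}`. -/
noncomputable def coordCLM (k : Fin n ⊕ Fin d) : CSpace n d →L[ℂ] ℂ :=
  Sum.elim (fun i => (ContinuousLinearMap.proj i).comp (ContinuousLinearMap.fst ℂ _ _))
    (fun i => (ContinuousLinearMap.proj i).comp (ContinuousLinearMap.snd ℂ _ _)) k

/-- The standard basis of `ℂ^{n+d}`. -/
noncomputable def coordVec (k : Fin n ⊕ Fin d) : CSpace n d :=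
  Sum.elim (fun i => (Pi.single i 1, 0)) (fun i => (0, Pi.single i 1)) k

theorem coordCLM_apply (k : Fin n ⊕ Fin d) (Z : CSpace n d) :
    coordCLM k Z = Sum.elim Z.1 Z.2 k := by
  cases k <;> rfl

theorem sum_coordCLM_smul_coordVec (Z : CSpace n d) :
    ∑ k, coordCLM k Z • coordVec k = Z := by
  rw [Fintype.sum_sum_type]
  ext i
  · simp [coordCLM, coordVec, Finset.sum_apply, Pi.single_apply, Prod.fst_sum]
  · simp [coordCLM, coordVec, Finset.sum_apply, Pi.single_apply, Prod.snd_sum]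

variable {E : Type*} [NormedAddCommGroup E] [NormedSpace ℂ E] {x : E}

/-- Chain rule for germs. -/
theorem germDerivation_comp {m : ℕ} (v : Fin m → E) {Θ : E → CSpace n d}
    (hΘ : AnalyticAt ℂ Θ x) {f : CSpace n d → ℂ} (hf : AnalyticAt ℂ f (Θ x)) :
    germDerivation v (germ (fun y => f (Θ y)) (hf.comp hΘ)) =
      ∑ k, germ (fun y => fderiv ℂ f (Θ y) (coordVec k))
          ((hf.fderiv_apply_const (coordVec k)).comp hΘ) •
        germDerivation v (germ (fun y => coordCLM k (Θ y))
          (((coordCLM k).analyticAt _).comp hΘ)) := by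
  ext j
  rw [Finset.sum_apply, germDerivation_germ]
  simp only [Pi.smul_apply, germDerivation_germ, smul_eq_mul, germ_mul]
  obtain ⟨h, hs⟩ := germ_sum Finset.univ fun k =>
    ((hf.fderiv_apply_const (coordVec k)).comp hΘ).mul
      ((((coordCLM k).analyticAt _).comp hΘ).fderiv_apply_const (v j))
  refine Eq.trans ?_ hs.symm
  rw [germ_eq_iff]
  filter_upwards [hΘ.eventually_analyticAt,
    hΘ.continuousAt.eventually hf.eventually_analyticAt] with y hy hfy
  have h1 : HasFDerivAt (fun y => f (Θ y)) ((fderiv ℂ f (Θ y)).comp (fderiv ℂ Θ y)) y :=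
    hfy.differentiableAt.hasFDerivAt.comp y hy.differentiableAt.hasFDerivAt
  have h2 (k) : HasFDerivAt (fun y => coordCLM k (Θ y)) ((coordCLM k).comp (fderiv ℂ Θ y)) y :=
    (coordCLM k).hasFDerivAt.comp y hy.differentiableAt.hasFDerivAt
  simp only [Pi.mul_apply, Function.comp_def]
  rw [h1.fderiv]
  simp only [(h2 _).fderiv, ContinuousLinearMap.comp_apply]
  conv_lhs => rw [← sum_coordCLM_smul_coordVec (fderiv ℂ Θ y (v j))]
  rw [map_sum]
  refine Finset.sum_congr rfl fun k _ => ?_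
  rw [map_smul, smul_eq_mul, mul_comm]

end Coordinates

/-! ### Uniqueness on the totally real image of `M`, and reality of the defining equation -/

/-- A function vanishing on a level set of a submersion has its differential vanishing on the
tangent space of the level set. -/
theorem HasStrictFDerivAt.apply_eq_zero_of_level {X Y G : Type*} [NormedAddCommGroup X]
    [NormedSpace ℝ X] [CompleteSpace X] [NormedAddCommGroup Y] [NormedSpace ℝ Y]
    [NormedAddCommGroup G] [NormedSpace ℝ G] [CompleteSpace G] {f : X → G} {f' : X →L[ℝ] G}
    {g : X → Y} {g' : X →L[ℝ] Y} {p : X} (hf : HasStrictFDerivAt f f' p)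
    (hsurj : Function.Surjective f') (hg : HasStrictFDerivAt g g' p) (hp : g p = 0)
    (h : ∀ᶠ x in 𝓝 p, f x = f p → g x = 0) {v : X} (hv : f' v = 0) : g' v = 0 := by
  refine (SeparatingDual.eq_zero_iff_forall_dual_eq_zero (R := ℝ) _).2 fun ℓ => ?_
  have hφ : HasStrictFDerivAt (fun x => ℓ (g x)) (ℓ.comp g') p := ℓ.hasStrictFDerivAt.comp p hg
  have hext : IsLocalExtrOn (fun x => ℓ (g x)) {x | f x = f p} p := by
    left
    refine eventually_nhdsWithin_iff.2 (h.mono fun x hx hxf => ?_)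
    simp [hx hxf, hp]
  -- Lagrange multipliers: `ℓ ∘ g` is zero on the level set, so `p` is a constrained extremum.
  -- Surjectivity of `f'` excludes the degenerate case `Λ₀ = 0`.
  obtain ⟨Λ, Λ₀, hne, hΛ⟩ := hext.exists_linear_map_of_hasStrictFDerivAt hf hφ
  have hΛ₀ : Λ₀ ≠ 0 := by
    rintro rfl
    refine hne (Prod.ext (LinearMap.ext fun y => ?_) rfl)
    obtain ⟨x, rfl⟩ := hsurj y
    simpa using hΛ x
  have h1 := hΛ v
  rw [hv, map_zero, zero_add, smul_eq_mul] at h1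
  exact (mul_eq_zero.1 h1).resolve_left hΛ₀

section Reflection

variable {n d : ℕ}

/-- The totally real embedding `Z ↦ (z, Z̄)`. -/
noncomputable def reflectCLM (n d : ℕ) : CSpace n d →L[ℝ] (Fin n → ℂ) × CSpace n d :=
  (ContinuousLinearMap.fst ℝ (Fin n → ℂ) (Fin d → ℂ)).prod
    ((starL' ℝ : CSpace n d ≃L[ℝ] CSpace n d) : CSpace n d →L[ℝ] CSpace n d)

theorem reflectCLM_apply (Z : CSpace n d) : reflectCLM n d Z = (Z.1, star Z) := rfl

/-- The image of the tangent space of a codimension `d` real submanifold `{w = Q(z, Z̄)}` under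
`reflectCLM` spans the whole space over `ℂ`. -/
theorem surjective_complexify_reflect {T : Submodule ℝ (CSpace n d)}
    (hT : Module.finrank ℝ T + d = 2 * (n + d))
    (Q' : (Fin n → ℂ) × CSpace n d →L[ℂ] Fin d → ℂ)
    (hQ' : ∀ v ∈ T, v.2 = Q' (reflectCLM n d v)) (e : (Fin n → ℂ) × CSpace n d) :
    ∃ v ∈ T, ∃ u ∈ T, e = reflectCLM n d v + Complex.I • reflectCLM n d u := by
  let Λ : (T × T) →ₗ[ℝ] (Fin n → ℂ) × CSpace n d :=
    { toFun := fun p => reflectCLM n d p.1 + Complex.I • reflectCLM n d p.2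
      map_add' := by
        intro p q
        simp only [Prod.fst_add, Prod.snd_add, Submodule.coe_add, map_add, smul_add]
        abel
      map_smul' := by
        intro c p
        simp only [Prod.smul_fst, Prod.smul_snd, Submodule.coe_smul, map_smul, smul_add,
          RingHom.id_apply]
        rw [smul_comm] }
  -- The conjugated component of the equation gives `v = i u`. The `z` component gives `v.1 = -i
  -- u.1`, and complex linearity of `Q'` gives the same for the `w` component; so `u = 0`.
  -- Surjectivity follows as both real dimensions are `2(2n + d)`.
  have hinj : Function.Injective Λ := by
    rw [← LinearMap.ker_eq_bot, LinearMap.ker_eq_bot']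
    rintro ⟨⟨v, hv⟩, ⟨u, hu⟩⟩ h
    have h0 : reflectCLM n d v + Complex.I • reflectCLM n d u = 0 := h
    have h1 : v.1 + Complex.I • u.1 = 0 := congrArg Prod.fst h0
    have h2 : star v + Complex.I • star u = 0 := congrArg Prod.snd h0
    have h3 : v = Complex.I • u := by
      have h4 := congrArg star h2
      rw [star_add, star_smul, star_star, star_star, star_zero] at h4
      rw [eq_neg_of_add_eq_zero_left h4]
      simp
    have hu1 : u.1 = 0 := by
      rw [h3] at h1
      have h5 : (2 * Complex.I) • u.1 = 0 := by
        rw [two_mul, add_smul]; exact h1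
      exact (smul_eq_zero.1 h5).resolve_left (by simp)
    have hu2 : u.2 = 0 := by
      have h6 : v.2 = - (Complex.I • u.2) := by
        rw [hQ' v hv, hQ' u hu, eq_neg_of_add_eq_zero_left h0, map_neg, map_smul]
      rw [h3] at h6
      have h5 : (2 * Complex.I) • u.2 = 0 := by
        rw [two_mul, add_smul]; exact eq_neg_iff_add_eq_zero.1 h6
      exact (smul_eq_zero.1 h5).resolve_left (by simp)
    have hu0 : u = 0 := Prod.ext hu1 hu2
    have hv0 : v = 0 := by rw [h3, hu0, smul_zero]
    subst hu0 hv0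
    rfl
  have hdim : Module.finrank ℝ (T × T) = Module.finrank ℝ ((Fin n → ℂ) × CSpace n d) := by
    have hC (m : ℕ) : Module.finrank ℝ (Fin m → ℂ) = m * 2 := by
      rw [Module.finrank_pi_fintype]
      simp
    rw [Module.finrank_prod, Module.finrank_prod, Module.finrank_prod, hC, hC]
    omega
  obtain ⟨⟨v, u⟩, h⟩ :=
    (LinearMap.injective_iff_surjective_of_finrank_eq_finrank hdim).1 hinj e
  exact ⟨v, v.2, u, u.2, h.symm⟩

variable {M : Set (CSpace n d)} {Q : (Fin n → ℂ) × CSpace n d → Fin d → ℂ}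

/-- If an analytic function vanishes on the image of `M = {w = Q(z, Z̄)}` under `Z ↦ (z, Z̄)`, so
does its differential. -/
theorem eventually_fderiv_eq_zero_of_reflect (hM : IsGenericSubmanifold d M)
    (hQ : AnalyticAt ℂ Q 0) (hMQ : ∀ᶠ Z : CSpace n d in 𝓝 0, Z ∈ M → Z.2 = Q (Z.1, star Z))
    {F : Type*} [NormedAddCommGroup F] [NormedSpace ℂ F] {G : (Fin n → ℂ) × CSpace n d → F}
    (hG : ∀ᶠ x in 𝓝 0, AnalyticAt ℂ G x)
    (h : ∀ᶠ Z in 𝓝 0, Z ∈ M → G (reflectCLM n d Z) = 0) :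
    ∀ᶠ Z in 𝓝 0, Z ∈ M → fderiv ℂ G (reflectCLM n d Z) = 0 := by
  have hcont : Tendsto (reflectCLM n d) (𝓝 0) (𝓝 0) := by
    have := (reflectCLM n d).continuous.tendsto 0
    rwa [map_zero] at this
  filter_upwards [hMQ.eventually_nhds, h.eventually_nhds, hMQ, h,
    hcont.eventually hG,
    hcont.eventually hQ.eventually_analyticAt] with p hp1 hp2 hp3 hp4 hp5 hp6 hpM
  obtain ⟨ρ, hρ, hρM, hsurj, -⟩ := hM p hpM
  have hρp : ρ p = 0 := hρM.self_of_nhds.1 hpM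
  have hlevel : ∀ᶠ Z in 𝓝 p, ρ Z = ρ p → Z ∈ M := by
    filter_upwards [hρM] with Z hZ h0
    exact hZ.2 (h0.trans hρp)
  set T : Submodule ℝ (CSpace n d) := (fderiv ℝ ρ p).ker with hTdef
  have hG' : HasStrictFDerivAt (fun Z => G (reflectCLM n d Z))
      (((fderiv ℂ G (reflectCLM n d p)).restrictScalars ℝ).comp (reflectCLM n d)) p :=
    (hp5.hasStrictFDerivAt.restrictScalars ℝ).comp p (reflectCLM n d).hasStrictFDerivAt
  have hQ' : HasStrictFDerivAt (fun Z : CSpace n d => Z.2 - Q (reflectCLM n d Z))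
      (ContinuousLinearMap.snd ℝ _ _ -
        ((fderiv ℂ Q (reflectCLM n d p)).restrictScalars ℝ).comp (reflectCLM n d)) p :=
    (ContinuousLinearMap.snd ℝ (Fin n → ℂ) (Fin d → ℂ)).hasStrictFDerivAt.sub
      ((hp6.hasStrictFDerivAt.restrictScalars ℝ).comp p (reflectCLM n d).hasStrictFDerivAt)
  have hTG : ∀ v ∈ T, fderiv ℂ G (reflectCLM n d p) (reflectCLM n d v) = 0 := by
    intro v hv
    refine hρ.hasStrictFDerivAt.apply_eq_zero_of_level hsurj hG' (hp4 hpM) ?_ hv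
    filter_upwards [hlevel, hp2] with Z h1 h2 h3
    exact h2 (h1 h3)
  have hTQ : ∀ v ∈ T, v.2 = fderiv ℂ Q (reflectCLM n d p) (reflectCLM n d v) := by
    intro v hv
    refine sub_eq_zero.1
      (hρ.hasStrictFDerivAt.apply_eq_zero_of_level hsurj hQ' (sub_eq_zero.2 (hp3 hpM)) ?_ hv)
    filter_upwards [hlevel, hp1] with Z h1 h2 h3
    exact sub_eq_zero.2 (h2 (h1 h3))
  have hdim : Module.finrank ℝ T + d = 2 * (n + d) := by
    have h1 := (fderiv ℝ ρ p : CSpace n d →ₗ[ℝ] Fin d → ℝ).finrank_range_add_finrank_ker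
    rw [LinearMap.range_eq_top.2 hsurj, finrank_top, Module.finrank_fin_fun, Module.finrank_prod,
      Module.finrank_pi_fintype, Module.finrank_pi_fintype] at h1
    simp only [Complex.finrank_real_complex, Finset.sum_const, Finset.card_univ, Fintype.card_fin,
      smul_eq_mul] at h1
    have h2 : Module.finrank ℝ T =
      Module.finrank ℝ (fderiv ℝ ρ p : CSpace n d →ₗ[ℝ] Fin d → ℝ).ker := rfl
    omega
  -- The complex differential vanishes on the reflected tangent space, which spans everything over
  -- `ℂ`.
  refine ContinuousLinearMap.ext fun e => ?_
  obtain ⟨v, hv, u, hu, rfl⟩ := surjective_complexify_reflect hdim _ hTQ e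
  rw [map_add, map_smul, hTG v hv, hTG u hu, smul_zero, add_zero]
  rfl

/-- The image of `M = {w = Q(z, Z̄)}` under `Z ↦ (z, Z̄)` is a set of uniqueness for analytic
functions. -/
theorem eventually_eq_zero_of_reflect (hM : IsGenericSubmanifold d M)
    (hM0 : (0 : CSpace n d) ∈ M)
    (hQ : AnalyticAt ℂ Q 0) (hMQ : ∀ᶠ Z : CSpace n d in 𝓝 0, Z ∈ M → Z.2 = Q (Z.1, star Z))
    {F : Type*} [NormedAddCommGroup F] [NormedSpace ℂ F] [CompleteSpace F]
    {G : (Fin n → ℂ) × CSpace n d → F}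
    (hG : AnalyticAt ℂ G 0) (h : ∀ᶠ Z in 𝓝 0, Z ∈ M → G (reflectCLM n d Z) = 0) :
    ∀ᶠ x in 𝓝 0, G x = 0 := by
  -- Induction on the order, applied to the multilinear-valued derivatives themselves; then the
  -- Taylor series of `G` at `0` is zero.
  have hit : ∀ m : ℕ, ∀ᶠ Z in 𝓝 0, Z ∈ M → iteratedFDeriv ℂ m G (reflectCLM n d Z) = 0 := by
    intro m
    induction m with
    | zero =>
      filter_upwards [h] with Z hZ hZM
      ext v
      rw [iteratedFDeriv_zero_apply, hZ hZM]
      rfl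
    | succ m ih =>
      have hm : ∀ᶠ x in 𝓝 0, AnalyticAt ℂ (iteratedFDeriv ℂ m G) x := by
        obtain ⟨s, hs, hso, h0⟩ := eventually_nhds_iff.1 hG.eventually_analyticAt
        exact eventually_nhds_iff.2 ⟨s, AnalyticOnNhd.iteratedFDeriv_of_isOpen hs hso m, hso, h0⟩
      filter_upwards [eventually_fderiv_eq_zero_of_reflect hM hQ hMQ hm ih] with Z hZ hZM
      ext v
      rw [iteratedFDeriv_succ_apply_left, hZ hZM]
      rfl
  have hzero : ∀ m, iteratedFDeriv ℂ m G 0 = 0 := by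
    intro m
    have := (hit m).self_of_nhds hM0
    rwa [map_zero] at this
  obtain ⟨p, r, hp⟩ := hG
  filter_upwards [Metric.eball_mem_nhds 0 hp.r_pos] with x hx
  have h1 := hp.hasSum_iteratedFDeriv hx
  rw [zero_add] at h1
  refine h1.unique ?_
  simp only [hzero]
  simp

/-- The conjugate function `Q̄(χ, z, w)`. -/
noncomputable def conjFun (Q : (Fin n → ℂ) × CSpace n d → Fin d → ℂ) :
    (Fin n → ℂ) × CSpace n d → Fin d → ℂ := fun x => star (Q (star x))

theorem AnalyticAt.conjFun {x : (Fin n → ℂ) × CSpace n d} (hQ : AnalyticAt ℂ Q (star x)) :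
    AnalyticAt ℂ (conjFun Q) x := hQ.star_star

/-- The reality of the complexified defining equation: `w = Q(z, χ, Q̄(χ, z, w))`. -/
theorem eventually_reality (hM : IsGenericSubmanifold d M) (hM0 : (0 : CSpace n d) ∈ M)
    (hQ : AnalyticAt ℂ Q 0) (hQ0 : Q 0 = 0)
    (hMQ : ∀ᶠ Z : CSpace n d in 𝓝 0, Z ∈ M → Z.2 = Q (Z.1, star Z)) :
    ∀ᶠ x : (Fin n → ℂ) × CSpace n d in 𝓝 0,
      Q (x.2.1, (x.1, conjFun Q x)) = x.2.2 := by
  have hΘ : AnalyticAt ℂ (fun x : (Fin n → ℂ) × CSpace n d => (x.2.1, (x.1, Q x))) 0 := by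
    have h1 : AnalyticAt ℂ (fun x : (Fin n → ℂ) × CSpace n d => x.2.1) 0 :=
      AnalyticAt.comp (g := Prod.fst) analyticAt_fst analyticAt_snd
    have h2 : AnalyticAt ℂ (fun x : (Fin n → ℂ) × CSpace n d => x.1) 0 :=
      analyticAt_fst
    exact h1.prod (h2.prod hQ)
  have hc : AnalyticAt ℂ (conjFun Q)
      ((fun x : (Fin n → ℂ) × CSpace n d => (x.2.1, (x.1, Q x))) 0) := by
    refine AnalyticAt.conjFun ?_
    simp only [Prod.fst_zero, Prod.snd_zero, hQ0]
    convert hQ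
    exact star_zero _
  -- This is `τ - Q̄(χ, z, Q(z, χ, τ))`. On the image of `M` one has `Q = w` and `τ = w̄`, so it
  -- vanishes there, hence identically near `0`; conjugating the identity gives the claim.
  have hG : AnalyticAt ℂ (fun x : (Fin n → ℂ) × CSpace n d =>
      x.2.2 - conjFun Q (x.2.1, (x.1, Q x))) 0 := by
    have h3 : AnalyticAt ℂ (fun x : (Fin n → ℂ) × CSpace n d => x.2.2) 0 :=
      AnalyticAt.comp (g := Prod.snd) analyticAt_snd analyticAt_snd
    exact h3.sub (AnalyticAt.comp (f := fun x : (Fin n → ℂ) × CSpace n d => (x.2.1, (x.1, Q x)))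
      hc hΘ)
  have key := eventually_eq_zero_of_reflect hM hM0 hQ hMQ hG (by
    filter_upwards [hMQ] with Z hZ hZM
    have h1 := hZ hZM
    simp only [reflectCLM_apply, ← h1, conjFun]
    have h2 : star ((star Z).1, Z.1, Z.2) = (Z.1, star Z) := by
      ext <;> simp
    rw [h2, ← h1]
    exact sub_self _)
  have hstar : Tendsto (star : (Fin n → ℂ) × CSpace n d → _) (𝓝 0) (𝓝 0) := by
    have := (continuous_star (R := (Fin n → ℂ) × CSpace n d)).tendsto 0
    rwa [star_zero] at this
  filter_upwards [hstar.eventually key] with x hx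
  have h1 := congrArg star (sub_eq_zero.1 hx)
  simp only [conjFun, star_star, Prod.snd_star, Prod.fst_star] at h1 ⊢
  rw [h1]
  have h2 : star (star x.2.1, star x.1, Q (star x)) = (x.2.1, x.1, star (Q (star x))) := by
    ext <;> simp
  rw [h2]

end Reflection

/-! ### Germs of `H` on the complexification and their independence -/

/-- A complex polynomial vanishing on a nonempty open set is zero. -/
theorem MvPolynomial.eq_zero_of_eventually_eval_eq_zero {σ : Type*} [Fintype σ]
    {p : MvPolynomial σ ℂ} {a : σ → ℂ} (h : ∀ᶠ y in 𝓝 a, MvPolynomial.eval y p = 0) : p = 0 := by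
  obtain ⟨r, hr, hball⟩ := Metric.eventually_nhds_iff_ball.1 h
  refine MvPolynomial.funext_set (fun i => Metric.ball (a i) r) (fun i => ?_) fun y hy => ?_
  · exact infinite_of_mem_nhds (a i) (Metric.ball_mem_nhds _ hr)
  · rw [map_zero]
    refine hball y ?_
    rw [ball_pi _ hr]
    exact hy

section Pullback

variable {E F : Type*} [NormedAddCommGroup E] [NormedSpace ℂ E] [NormedAddCommGroup F]
  [NormedSpace ℂ F] {x : E}

noncomputable instance (x : E) : Algebra ℝ (AnalyticGerm x) :=
  Algebra.compHom _ (algebraMap ℝ ℂ)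

instance (x : E) : IsScalarTower ℝ ℂ (AnalyticGerm x) :=
  IsScalarTower.of_algebraMap_eq fun _ => rfl

/-- The germs at `x` of the functions `f ∘ Θ`. -/
def pullbackGerms {Θ : E → F} (hΘ : AnalyticAt ℂ Θ x) : Subalgebra ℂ (AnalyticGerm x) where
  carrier := {a | ∃ f : F → ℂ, ∃ hf : AnalyticAt ℂ f (Θ x),
    a = germ (fun y => f (Θ y)) (hf.comp hΘ)}
  mul_mem' := by
    rintro _ _ ⟨f, hf, rfl⟩ ⟨g, hg, rfl⟩
    exact ⟨_, hf.mul hg, rfl⟩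
  add_mem' := by
    rintro _ _ ⟨f, hf, rfl⟩ ⟨g, hg, rfl⟩
    exact ⟨_, hf.add hg, rfl⟩
  algebraMap_mem' c := ⟨fun _ => c, analyticAt_const, rfl⟩

end Pullback

section Coordinates

variable {n d : ℕ}

/-- The point with given coordinates. -/
def ofCoords (c : Fin n ⊕ Fin d → ℂ) : CSpace n d := (fun i => c (Sum.inl i), fun i => c (Sum.inr i))

theorem continuous_ofCoords : Continuous (ofCoords (n := n) (d := d)) := by
  unfold ofCoords
  fun_prop

theorem coordCLM_ofCoords (c : Fin n ⊕ Fin d → ℂ) (k) : coordCLM k (ofCoords c) = c k := by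
  cases k <;> rfl

theorem ofCoords_coordCLM (Z : CSpace n d) : ofCoords (fun k => coordCLM k Z) = Z := rfl

theorem coordCLM_star (Z : CSpace n d) (k) : coordCLM k (star Z) = star (coordCLM k Z) := by
  cases k <;> rfl

/-- The direction of the coordinate `z_j`. -/
noncomputable def zDir (n d : ℕ) (j : Fin n) : (Fin n → ℂ) × CSpace n d := (Pi.single j 1, 0)

/-- The map `(z, ζ) ↦ (z, Q(z, ζ))`. -/
def segreMap (Q : (Fin n → ℂ) × CSpace n d → Fin d → ℂ) (x : (Fin n → ℂ) × CSpace n d) :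
    CSpace n d := (x.1, Q x)

variable {Q : (Fin n → ℂ) × CSpace n d → Fin d → ℂ}

theorem analyticAt_segreMap {x} (hQ : AnalyticAt ℂ Q x) : AnalyticAt ℂ (segreMap Q) x :=
  analyticAt_fst.prod hQ

theorem segreMap_zero (hQ0 : Q 0 = 0) : segreMap Q 0 = 0 := Prod.ext rfl hQ0

variable {H : CSpace n d → CSpace n d}

/-- The germs of the coordinates of `H(z, Q(z, ζ))`. -/
noncomputable def targetGerm (hQ : AnalyticAt ℂ Q 0) (hH : AnalyticAt ℂ H (segreMap Q 0))
    (k : Fin n ⊕ Fin d) : AnalyticGerm (0 : (Fin n → ℂ) × CSpace n d) :=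
  germ (fun y => coordCLM k (H (segreMap Q y)))
    (((coordCLM k).analyticAt _).comp (hH.comp (analyticAt_segreMap hQ)))

theorem analyticAt_conj_snd (hH : AnalyticAt ℂ H 0) :
    AnalyticAt ℂ (fun y : (Fin n → ℂ) × CSpace n d => star (H (star y.2))) 0 := by
  have h1 : AnalyticAt ℂ (fun y => star (H (star y))) (0 : CSpace n d) := by
    refine AnalyticAt.star_star ?_
    rwa [star_zero]
  exact AnalyticAt.comp (g := fun y => star (H (star y))) (f := Prod.snd)
    (x := (0 : (Fin n → ℂ) × CSpace n d)) h1 analyticAt_snd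

/-- The germs of the coordinates of the conjugate of `H(ζ̄)`. -/
noncomputable def targetConjGerm (hH : AnalyticAt ℂ H 0) (k : Fin n ⊕ Fin d) :
    AnalyticGerm (0 : (Fin n → ℂ) × CSpace n d) :=
  germ (fun y => coordCLM k (star (H (star y.2))))
    (((coordCLM k).analyticAt _).comp (analyticAt_conj_snd hH))

theorem germDerivation_targetConjGerm (hH : AnalyticAt ℂ H 0) (k : Fin n ⊕ Fin d) :
    germDerivation (zDir n d) (targetConjGerm hH k) = 0 := by
  ext j
  rw [targetConjGerm, germDerivation_germ]
  refine germ_eq_zero_iff.2 ?_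
  have h1 : AnalyticAt ℂ (fun y => coordCLM k (star (H (star y)))) (0 : CSpace n d) := by
    refine ((coordCLM k).analyticAt _).comp (AnalyticAt.star_star ?_)
    rwa [star_zero]
  have h2 : Tendsto (Prod.snd : (Fin n → ℂ) × CSpace n d → _) (𝓝 0) (𝓝 0) :=
    continuous_snd.tendsto 0
  filter_upwards [h2.eventually h1.eventually_analyticAt] with y hy
  have h3 : HasFDerivAt (fun y : (Fin n → ℂ) × CSpace n d => coordCLM k (star (H (star y.2))))
      _ y := hy.differentiableAt.hasFDerivAt.comp y hasFDerivAt_snd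
  rw [h3.fderiv]
  simp [zDir]

theorem targetGerm_mem (hQ : AnalyticAt ℂ Q 0) (hH : AnalyticAt ℂ H (segreMap Q 0))
    (k : Fin n ⊕ Fin d) : targetGerm hQ hH k ∈ pullbackGerms (analyticAt_segreMap hQ) :=
  ⟨fun Z => coordCLM k (H Z), ((coordCLM k).analyticAt _).comp hH, rfl⟩

/-- The germs of the coordinates of `(z, Q(z, ζ))`. -/
noncomputable def sourceGerm (hQ : AnalyticAt ℂ Q 0)
    (k : Fin n ⊕ Fin d) : AnalyticGerm (0 : (Fin n → ℂ) × CSpace n d) :=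
  germ (fun y => coordCLM k (segreMap Q y))
    (((coordCLM k).analyticAt _).comp (analyticAt_segreMap hQ))

theorem germDerivation_sourceGerm_inl (hQ : AnalyticAt ℂ Q 0) (l : Fin n) :
    germDerivation (zDir n d) (sourceGerm hQ (Sum.inl l)) = Pi.single l 1 := by
  ext j
  rw [sourceGerm, germDerivation_germ]
  have h1 (y : (Fin n → ℂ) × CSpace n d) :
      HasFDerivAt (fun y : (Fin n → ℂ) × CSpace n d => coordCLM (Sum.inl l) (segreMap Q y))
      ((ContinuousLinearMap.proj l).comp (ContinuousLinearMap.fst ℂ (Fin n → ℂ) (CSpace n d))) y :=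
    ((ContinuousLinearMap.proj l).comp
      (ContinuousLinearMap.fst ℂ (Fin n → ℂ) (CSpace n d))).hasFDerivAt
  by_cases hlj : j = l
  · subst hlj
    rw [Pi.single_eq_same]
    have : (1 : AnalyticGerm (0 : (Fin n → ℂ) × CSpace n d)) = germ (fun _ => 1) analyticAt_const :=
      rfl
    rw [this, germ_eq_iff]
    refine Eventually.of_forall fun y => ?_
    simp only
    rw [(h1 y).fderiv]
    simp [zDir]
  · rw [Pi.single_eq_of_ne hlj, germ_eq_zero_iff]
    refine Eventually.of_forall fun y => ?_
    rw [(h1 y).fderiv]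
    simp [zDir, Ne.symm hlj]

/-- The differentials of the coordinates of the source are combinations of those of the target. -/
theorem exists_germDerivation_sourceGerm_eq (hQ : AnalyticAt ℂ Q 0)
    (hH : AnalyticAt ℂ H (segreMap Q 0)) {K : CSpace n d → CSpace n d}
    (hK : AnalyticAt ℂ K (H (segreMap Q 0))) (hKH : ∀ᶠ Z in 𝓝 (segreMap Q 0), K (H Z) = Z)
    (k : Fin n ⊕ Fin d) :
    ∃ J : Fin n ⊕ Fin d → AnalyticGerm (0 : (Fin n → ℂ) × CSpace n d),
      (∀ i, J i ∈ pullbackGerms (analyticAt_segreMap hQ)) ∧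
      germDerivation (zDir n d) (sourceGerm hQ k) =
        ∑ i, J i • germDerivation (zDir n d) (targetGerm hQ hH i) := by
  have hf : AnalyticAt ℂ (fun Z => coordCLM k (K Z)) (H (segreMap Q 0)) :=
    ((coordCLM k).analyticAt _).comp hK
  have hΘ : AnalyticAt ℂ (fun y => H (segreMap Q y)) 0 := hH.comp (analyticAt_segreMap hQ)
  refine ⟨_, fun i => ?_, Eq.trans ?_ (germDerivation_comp (zDir n d) hΘ hf)⟩
  · exact ⟨fun Z => fderiv ℂ (fun Z => coordCLM k (K Z)) (H Z) (coordVec i),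
      (hf.fderiv_apply_const _).comp hH, rfl⟩
  · congr 1
    rw [sourceGerm, germ_eq_iff]
    filter_upwards [(analyticAt_segreMap hQ).continuousAt.eventually hKH] with y hy
    rw [hy]

/-- The chain rule reduces derivatives of all of `A` to those of the coordinates of `(z, Q(z, ζ))`.
-/
theorem exists_germDerivation_pullback_eq (hQ : AnalyticAt ℂ Q 0)
    {a : AnalyticGerm (0 : (Fin n → ℂ) × CSpace n d)}
    (ha : a ∈ pullbackGerms (analyticAt_segreMap hQ)) :
    ∃ J : Fin n ⊕ Fin d → AnalyticGerm (0 : (Fin n → ℂ) × CSpace n d),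
      (∀ i, J i ∈ pullbackGerms (analyticAt_segreMap hQ)) ∧
      germDerivation (zDir n d) a =
        ∑ i, J i • germDerivation (zDir n d) (sourceGerm hQ i) := by
  obtain ⟨f, hf, rfl⟩ := ha
  refine ⟨_, fun i => ?_, germDerivation_comp (zDir n d) (analyticAt_segreMap hQ) hf⟩
  exact ⟨fun Z => fderiv ℂ f Z (coordVec i), hf.fderiv_apply_const _, rfl⟩

/-- The conjugate of `H` is locally invertible in `ζ`, so these functions take all values near their
value at `0`; a polynomial vanishing on an open set is zero. -/
theorem algebraicIndependent_targetConjGerm (hH : AnalyticAt ℂ H 0)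
    {K : CSpace n d → CSpace n d} (hK : ContinuousAt K (H 0)) (hK0 : K (H 0) = 0)
    (hHK : ∀ᶠ Y in 𝓝 (H 0), H (K Y) = Y) :
    AlgebraicIndependent ℂ (targetConjGerm hH) := by
  rw [algebraicIndependent_iff]
  intro p hp
  obtain ⟨h1, h2⟩ := aeval_germ (x := (0 : (Fin n → ℂ) × CSpace n d))
    (F := fun k y => coordCLM k (star (H (star y.2))))
    (fun k => ((coordCLM k).analyticAt _).comp (analyticAt_conj_snd hH)) p
  have h3 : ∀ᶠ y : (Fin n → ℂ) × CSpace n d in 𝓝 0,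
      MvPolynomial.eval (fun k => coordCLM k (star (H (star y.2)))) p = 0 :=
    germ_eq_zero_iff.1 (h2.symm.trans hp)
  refine MvPolynomial.eq_zero_of_eventually_eval_eq_zero
    (a := fun k => coordCLM k (star (H 0))) ?_
  have hc1 : Tendsto (fun c => star (ofCoords (n := n) (d := d) c))
      (𝓝 fun k => coordCLM k (star (H 0))) (𝓝 (H 0)) := by
    have := (continuous_star.comp (continuous_ofCoords (n := n) (d := d))).tendsto
      (fun k => coordCLM k (star (H 0)))
    rwa [Function.comp_apply, ofCoords_coordCLM, star_star] at this
  have hc2 : Tendsto (fun c => ((0 : Fin n → ℂ), star (K (star (ofCoords (n := n) (d := d) c)))))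
      (𝓝 fun k => coordCLM k (star (H 0))) (𝓝 0) := by
    have h4 := (continuous_star.tendsto _).comp (hK.tendsto.comp hc1)
    rw [hK0, star_zero] at h4
    exact tendsto_const_nhds.prodMk_nhds h4
  filter_upwards [hc2.eventually h3, hc1.eventually hHK] with c h4 h5
  simp only [star_star, h5, coordCLM_ofCoords] at h4
  exact h4

/-- By reality, `(z, Q(z, ζ))` reaches every `(z, w)` near `0`, already with `χ = 0` and `τ = Q̄(0,
z, w)`. So `H(z, Q(z, ζ))` fills a neighbourhood of `H 0`. -/
theorem algebraicIndependent_targetGerm (hQ : AnalyticAt ℂ Q 0) (hQ0 : Q 0 = 0)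
    (hH : AnalyticAt ℂ H (segreMap Q 0))
    (hreal : ∀ᶠ x : (Fin n → ℂ) × CSpace n d in 𝓝 0, Q (x.2.1, (x.1, conjFun Q x)) = x.2.2)
    {K : CSpace n d → CSpace n d} (hK : ContinuousAt K (H 0)) (hK0 : K (H 0) = 0)
    (hHK : ∀ᶠ Y in 𝓝 (H 0), H (K Y) = Y) :
    AlgebraicIndependent ℂ (targetGerm hQ hH) := by
  rw [algebraicIndependent_iff]
  intro p hp
  obtain ⟨h1, h2⟩ := aeval_germ (x := (0 : (Fin n → ℂ) × CSpace n d))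
    (F := fun k y => coordCLM k (H (segreMap Q y)))
    (fun k => ((coordCLM k).analyticAt _).comp (hH.comp (analyticAt_segreMap hQ))) p
  have h3 : ∀ᶠ y : (Fin n → ℂ) × CSpace n d in 𝓝 0,
      MvPolynomial.eval (fun k => coordCLM k (H (segreMap Q y))) p = 0 :=
    germ_eq_zero_iff.1 (h2.symm.trans hp)
  refine MvPolynomial.eq_zero_of_eventually_eval_eq_zero (a := fun k => coordCLM k (H 0)) ?_
  have hc1 : Tendsto (ofCoords (n := n) (d := d))
      (𝓝 fun k => coordCLM k (H 0)) (𝓝 (H 0)) :=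
    (continuous_ofCoords (n := n) (d := d)).tendsto (fun k => coordCLM k (H 0))
  have hc2 : Tendsto (fun c => ((0 : Fin n → ℂ), K (ofCoords (n := n) (d := d) c)))
      (𝓝 fun k => coordCLM k (H 0)) (𝓝 0) := by
    have h4 := hK.tendsto.comp hc1
    rw [hK0] at h4
    exact tendsto_const_nhds.prodMk_nhds h4
  have hconj : ContinuousAt (conjFun Q) 0 := by
    refine (AnalyticAt.conjFun ?_).continuousAt
    rwa [star_zero]
  have hconj0 : conjFun Q 0 = 0 := by
    rw [conjFun, star_zero, hQ0, star_zero]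
  have hc3 : Tendsto (fun x : (Fin n → ℂ) × CSpace n d => (x.2.1, (x.1, conjFun Q x)))
      (𝓝 0) (𝓝 0) := by
    have h4 : ContinuousAt (fun x : (Fin n → ℂ) × CSpace n d => (x.2.1, (x.1, conjFun Q x))) 0 :=
      (continuous_snd.fst.continuousAt).prodMk (continuousAt_fst.prodMk hconj)
    have h5 := h4.tendsto
    rw [hconj0] at h5
    exact h5
  filter_upwards [hc2.eventually (hc3.eventually h3), hc2.eventually hreal,
    hc1.eventually hHK] with c h4 h5 h6
  rw [segreMap] at h4
  rw [h5] at h4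
  simp only [Prod.mk.eta, h6, coordCLM_ofCoords] at h4
  exact h4

end Coordinates

/-! ### From real-algebraicity to a transcendence bound -/

theorem adjoin_subset_adjoin_of_isScalarTower (k K : Type*) {O : Type*} [CommRing k] [CommRing K]
    [Algebra k K] [CommRing O] [Algebra k O] [Algebra K O] [IsScalarTower k K O] (s : Set O) :
    (Algebra.adjoin k s : Set O) ⊆ Algebra.adjoin K s :=
  Algebra.adjoin_le (S := (Algebra.adjoin K s).restrictScalars k) Algebra.subset_adjoin

section RealAlgebraic

variable {n d : ℕ}

/-- The holomorphic extensions of the real coordinates composed with `H`, as functions of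
`(z, ζ)`. -/
noncomputable def realCoordFun (H : CSpace n d → CSpace n d)
    (Q : (Fin n → ℂ) × CSpace n d → Fin d → ℂ) (k : RealIdx n d) (y : (Fin n → ℂ) × CSpace n d) :
    ℂ :=
  Sum.elim
    (fun k => 1 / 2 * (coordCLM k (H (segreMap Q y)) + coordCLM k (star (H (star y.2)))))
    (fun k => -Complex.I / 2 *
      (coordCLM k (H (segreMap Q y)) + (-1) * coordCLM k (star (H (star y.2))))) k

variable {H : CSpace n d → CSpace n d} {Q : (Fin n → ℂ) × CSpace n d → Fin d → ℂ}

/-- On the image of `M` the two arguments are genuine conjugates, so the formulas for real and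
imaginary parts apply. This lets real equations of the target be read on the complexification. -/
theorem realCoordFun_reflect {Z : CSpace n d} (hZ : Z.2 = Q (Z.1, star Z)) (k : RealIdx n d) :
    realCoordFun H Q k (reflectCLM n d Z) = (realCoords (H Z) k : ℂ) := by
  have h1 : segreMap Q (reflectCLM n d Z) = Z := Prod.ext rfl hZ.symm
  rw [realCoordFun, h1, reflectCLM_apply]
  simp only [star_star, coordCLM_star]
  rcases k with k | k
  · simp only [Sum.elim_inl, realCoords, ← coordCLM_apply]
    rw [Complex.re_eq_add_conj]
    simp only [RCLike.star_def]
    ring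
  · simp only [Sum.elim_inr, realCoords, ← coordCLM_apply]
    rw [Complex.im_eq_sub_conj]
    simp only [RCLike.star_def]
    field_simp
    rw [Complex.I_sq]
    ring

theorem analyticAt_realCoordFun (hQ : AnalyticAt ℂ Q 0) (hH : AnalyticAt ℂ H (segreMap Q 0))
    (hH0 : AnalyticAt ℂ H 0) (k : RealIdx n d) : AnalyticAt ℂ (realCoordFun H Q k) 0 := by
  have h1 (k) : AnalyticAt ℂ (fun y => coordCLM k (H (segreMap Q y))) 0 :=
    ((coordCLM k).analyticAt _).comp (hH.comp (analyticAt_segreMap hQ))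
  have h2 (k : Fin n ⊕ Fin d) : AnalyticAt ℂ
      (fun y : (Fin n → ℂ) × CSpace n d => coordCLM k (star (H (star y.2)))) 0 :=
    ((coordCLM k).analyticAt _).comp (analyticAt_conj_snd hH0)
  rcases k with k | k
  · exact analyticAt_const.mul ((h1 k).add (h2 k))
  · exact analyticAt_const.mul ((h1 k).add (analyticAt_const.mul (h2 k)))

theorem germ_realCoordFun_inl (hQ : AnalyticAt ℂ Q 0) (hH : AnalyticAt ℂ H (segreMap Q 0))
    (hH0 : AnalyticAt ℂ H 0) (k : Fin n ⊕ Fin d) :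
    germ _ (analyticAt_realCoordFun hQ hH hH0 (Sum.inl k)) =
      (1 / 2 : ℂ) • (targetGerm hQ hH k + targetConjGerm hH0 k) := rfl

theorem germ_realCoordFun_inr (hQ : AnalyticAt ℂ Q 0) (hH : AnalyticAt ℂ H (segreMap Q 0))
    (hH0 : AnalyticAt ℂ H 0) (k : Fin n ⊕ Fin d) :
    germ _ (analyticAt_realCoordFun hQ hH hH0 (Sum.inr k)) =
      (-Complex.I / 2 : ℂ) • (targetGerm hQ hH k + (-1 : ℂ) • targetConjGerm hH0 k) := rfl

theorem targetGerm_eq (hQ : AnalyticAt ℂ Q 0) (hH : AnalyticAt ℂ H (segreMap Q 0))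
    (hH0 : AnalyticAt ℂ H 0) (k : Fin n ⊕ Fin d) :
    targetGerm hQ hH k = germ _ (analyticAt_realCoordFun hQ hH hH0 (Sum.inl k)) +
      Complex.I • germ _ (analyticAt_realCoordFun hQ hH hH0 (Sum.inr k)) := by
  rw [germ_realCoordFun_inl hQ hH hH0, germ_realCoordFun_inr hQ hH hH0]
  generalize targetGerm hQ hH k = a
  generalize targetConjGerm hH0 k = b
  rw [smul_smul, show Complex.I * (-Complex.I / 2) = 1 / 2 by linear_combination (-1 / 2) * Complex.I_mul_I]
  module

theorem targetConjGerm_eq (hQ : AnalyticAt ℂ Q 0) (hH : AnalyticAt ℂ H (segreMap Q 0))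
    (hH0 : AnalyticAt ℂ H 0) (k : Fin n ⊕ Fin d) :
    targetConjGerm hH0 k = germ _ (analyticAt_realCoordFun hQ hH hH0 (Sum.inl k)) +
      (-Complex.I) • germ _ (analyticAt_realCoordFun hQ hH hH0 (Sum.inr k)) := by
  rw [germ_realCoordFun_inl hQ hH hH0, germ_realCoordFun_inr hQ hH hH0]
  generalize targetGerm hQ hH k = a
  generalize targetConjGerm hH0 k = b
  rw [smul_smul, show -Complex.I * (-Complex.I / 2) = -1 / 2 by linear_combination (1 / 2) * Complex.I_mul_I]
  module

variable {M : Set (CSpace n d)}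

/-- If `H(M)` lies in a real-algebraic set of dimension `m`, then the germs of the coordinates of
the complexification of `H` have transcendence degree at most `m`. -/
theorem exists_transcendence_generators (hM : IsGenericSubmanifold d M)
    (hM0 : (0 : CSpace n d) ∈ M)
    (hQ : AnalyticAt ℂ Q 0) (hMQ : ∀ᶠ Z : CSpace n d in 𝓝 0, Z ∈ M → Z.2 = Q (Z.1, star Z))
    (hH : AnalyticAt ℂ H (segreMap Q 0)) (hH0 : AnalyticAt ℂ H 0) {V : Set (RealIdx n d → ℝ)}
    (hMV : ∀ᶠ Z in 𝓝 0, Z ∈ M → realCoords (H Z) ∈ V) {m : ℕ}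
    (hV : realAlgDim V = (m : WithBot ℕ∞)) :
    ∃ s ≤ m, ∃ t : Fin s → AnalyticGerm (0 : (Fin n → ℂ) × CSpace n d),
      (∀ i, t i ∈ Algebra.adjoin ℂ
        (Set.range (targetGerm hQ hH) ∪ Set.range (targetConjGerm hH0))) ∧
      (∀ k, IsAlgebraic (Algebra.adjoin ℂ (Set.range t)) (targetGerm hQ hH k)) ∧
      ∀ k, IsAlgebraic (Algebra.adjoin ℂ (Set.range t)) (targetConjGerm hH0 k) := by
  set g : RealIdx n d → AnalyticGerm (0 : (Fin n → ℂ) × CSpace n d) :=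
    fun k => germ _ (analyticAt_realCoordFun hQ hH hH0 k) with hg
  let φ : MvPolynomial (RealIdx n d) ℝ →ₐ[ℝ] AnalyticGerm (0 : (Fin n → ℂ) × CSpace n d) :=
    MvPolynomial.aeval g
  have hφ : ∀ p ∈ MvPolynomial.vanishingIdeal ℝ V, φ p = 0 := by
    intro p hp
    obtain ⟨h1, h2⟩ := aeval_germ (analyticAt_realCoordFun hQ hH hH0)
      (MvPolynomial.map (algebraMap ℝ ℂ) p)
    rw [MvPolynomial.aeval_map_algebraMap] at h2
    refine h2.trans (germ_eq_zero_iff.2 ?_)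
    -- A real polynomial vanishing on `V` vanishes on the image of `M`, hence on the whole
    -- complexification near `0`.
    refine eventually_eq_zero_of_reflect hM hM0 hQ hMQ h1 ?_
    filter_upwards [hMQ, hMV] with Z hZ1 hZ2 hZM
    simp only [realCoordFun_reflect (hZ1 hZM)]
    have h3 := MvPolynomial.mem_vanishingIdeal_iff.1 hp _ (hZ2 hZM)
    rw [MvPolynomial.eval_map]
    have h4 := MvPolynomial.aeval_algebraMap_apply (B := ℂ) (realCoords (H Z)) p
    rw [h3, map_zero] at h4
    exact h4
  obtain ⟨s, hs, t, ht, halg⟩ := exists_algebraic_range_of_ringKrullDim φ _ hφ hV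
  have hle : Algebra.adjoin ℝ (Set.range g) ≤ (Algebra.adjoin ℂ
      (Set.range (targetGerm hQ hH) ∪ Set.range (targetConjGerm hH0))).restrictScalars ℝ := by
    refine Algebra.adjoin_le ?_
    set S := Algebra.adjoin ℂ (Set.range (targetGerm hQ hH) ∪ Set.range (targetConjGerm hH0))
      with hS
    have h1 (k) : targetGerm hQ hH k ∈ S := Algebra.subset_adjoin (Or.inl ⟨k, rfl⟩)
    have h2 (k) : targetConjGerm hH0 k ∈ S := Algebra.subset_adjoin (Or.inr ⟨k, rfl⟩)
    rintro _ ⟨k | k, rfl⟩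
    · exact S.smul_mem (S.add_mem (h1 k) (h2 k)) _
    · exact S.smul_mem (S.add_mem (h1 k) (S.smul_mem (h2 k) _)) _
  -- Algebraicity over `ℝ[t]` persists over `ℂ[t]`, where `targetGerm` and `targetConjGerm` are
  -- linear combinations of the `g k`.
  set T := (Algebra.adjoin ℂ (Set.range t)).algClosure with hT
  have hgT : ∀ k, g k ∈ T := by
    intro k
    have h1 := halg (MvPolynomial.X k)
    rw [show φ (MvPolynomial.X k) = g k from MvPolynomial.aeval_X _ _] at h1
    refine h1.of_subalgebra_subset ?_
    exact adjoin_subset_adjoin_of_isScalarTower ℝ ℂ _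
  refine ⟨s, hs, t, fun i => hle ?_, fun k => ?_, fun k => ?_⟩
  · rw [Algebra.adjoin_range_eq_range_aeval]
    exact ht i
  · rw [targetGerm_eq hQ hH hH0]
    exact T.add_mem (hgT _) (T.smul_mem (hgT _) _)
  · rw [targetConjGerm_eq hQ hH hH0]
    exact T.add_mem (hgT _) (T.smul_mem (hgT _) _)

end RealAlgebraic

/-! ### Derivatives of `Q` and their relation over functions of `(z, w)` -/

section Relation

variable {n d : ℕ}

/-- The derivative in `z_j` of a function of `(z, ζ)`. -/
noncomputable def zDeriv (j : Fin n) (g : (Fin n → ℂ) × CSpace n d → ℂ) :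
    (Fin n → ℂ) × CSpace n d → ℂ :=
  fun x => partialDeriv j (fun z => g (z, x.2)) x.1

/-- The iterated derivative in `z` of a function of `(z, ζ)`. -/
noncomputable def zMultiDeriv (α : Fin n → ℕ) (g : (Fin n → ℂ) × CSpace n d → ℂ) :
    (Fin n → ℂ) × CSpace n d → ℂ :=
  (List.finRange n).foldr (fun j g => (zDeriv j)^[α j] g) g

theorem zMultiDeriv_apply (α : Fin n → ℕ) (g : (Fin n → ℂ) × CSpace n d → ℂ)
    (z : Fin n → ℂ) (ζ : CSpace n d) :
    zMultiDeriv α g (z, ζ) = multiDeriv α (fun z => g (z, ζ)) z := by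
  have h1 (j : Fin n) (m : ℕ) (g : (Fin n → ℂ) × CSpace n d → ℂ) :
      (fun z => ((zDeriv j)^[m] g) (z, ζ)) = (partialDeriv j)^[m] (fun z => g (z, ζ)) := by
    induction m generalizing g with
    | zero => rfl
    | succ m ih => rw [Function.iterate_succ_apply, Function.iterate_succ_apply, ih]; rfl
  have h2 (l : List (Fin n)) :
      (fun z => (l.foldr (fun j g => (zDeriv j)^[α j] g) g) (z, ζ)) =
        l.foldr (fun j g => (partialDeriv j)^[α j] g) (fun z => g (z, ζ)) := by
    induction l with
    | nil => rfl
    | cons j l ih => rw [List.foldr_cons, List.foldr_cons, h1, ih]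
  exact congrFun (h2 _) z

theorem zMultiDeriv_induction {p : ((Fin n → ℂ) × CSpace n d → ℂ) → Prop}
    (hp : ∀ j g, p g → p (zDeriv j g)) (α : Fin n → ℕ) {g : (Fin n → ℂ) × CSpace n d → ℂ}
    (hg : p g) : p (zMultiDeriv α g) := by
  have h1 (j : Fin n) (m : ℕ) (g) (hg : p g) : p ((zDeriv j)^[m] g) := by
    induction m generalizing g with
    | zero => exact hg
    | succ m ih => exact ih _ (hp j g hg)
  unfold zMultiDeriv
  induction List.finRange n with
  | nil => exact hg
  | cons j l ih => exact h1 j _ _ ih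

theorem zDeriv_eq_fderiv {g : (Fin n → ℂ) × CSpace n d → ℂ} {x : (Fin n → ℂ) × CSpace n d}
    (hg : DifferentiableAt ℂ g x) (j : Fin n) : zDeriv j g x = fderiv ℂ g x (zDir n d j) := by
  have h1 : HasFDerivAt (fun z : Fin n → ℂ => (z, x.2))
      ((ContinuousLinearMap.id ℂ (Fin n → ℂ)).prod 0) x.1 :=
    (hasFDerivAt_id x.1).prodMk (hasFDerivAt_const _ _)
  have h2 : HasFDerivAt (fun z => g (z, x.2)) _ x.1 :=
    HasFDerivAt.comp (g := g) x.1 hg.hasFDerivAt h1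
  rw [zDeriv, partialDeriv, h2.fderiv]
  rfl

theorem AnalyticAt.zDeriv_eventuallyEq {g : (Fin n → ℂ) × CSpace n d → ℂ}
    {x : (Fin n → ℂ) × CSpace n d} (hg : AnalyticAt ℂ g x) (j : Fin n) :
    zDeriv j g =ᶠ[𝓝 x] fun y => fderiv ℂ g y (zDir n d j) := by
  filter_upwards [hg.eventually_analyticAt] with y hy
  exact zDeriv_eq_fderiv hy.differentiableAt j

theorem AnalyticAt.zDeriv {g : (Fin n → ℂ) × CSpace n d → ℂ}
    {x : (Fin n → ℂ) × CSpace n d} (hg : AnalyticAt ℂ g x) (j : Fin n) :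
    AnalyticAt ℂ (zDeriv j g) x :=
  (hg.fderiv_apply_const _).congr (hg.zDeriv_eventuallyEq j).symm

theorem AnalyticAt.zMultiDeriv {g : (Fin n → ℂ) × CSpace n d → ℂ}
    {x : (Fin n → ℂ) × CSpace n d} (hg : AnalyticAt ℂ g x) (α : Fin n → ℕ) :
    AnalyticAt ℂ (zMultiDeriv α g) x :=
  zMultiDeriv_induction (p := fun g => AnalyticAt ℂ g x) (fun j _ h => h.zDeriv j) α hg

/-- Algebraic dependence of germs over the pullbacks of germs, in terms of functions. -/
theorem exists_relation_of_not_algebraicIndependent {E F : Type*} [NormedAddCommGroup E]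
    [NormedSpace ℂ E] [NormedAddCommGroup F] [NormedSpace ℂ F] {x : E} {Θ : E → F}
    (hΘ : AnalyticAt ℂ Θ x) {m : ℕ} {f : Fin m → E → ℂ} (hf : ∀ s, AnalyticAt ℂ (f s) x)
    (h : ¬ AlgebraicIndependent (pullbackGerms hΘ) fun s => germ (f s) (hf s)) :
    ∃ (S : Finset (Fin m →₀ ℕ)) (a : S → F → ℂ), (∀ μ, AnalyticAt ℂ (a μ) (Θ x)) ∧
      (∃ μ, ¬ ∀ᶠ Z in 𝓝 (Θ x), a μ Z = 0) ∧
      ∀ᶠ y in 𝓝 x, ∑ μ, a μ (Θ y) * ∏ s, f s y ^ (μ : Fin m →₀ ℕ) s = 0 := by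
  rw [algebraicIndependent_iff] at h
  push Not at h
  obtain ⟨P, hP, hP0⟩ := h
  choose a ha hPa using fun μ : P.support => (MvPolynomial.coeff (μ : Fin m →₀ ℕ) P).2
  refine ⟨P.support, a, ha, ?_, ?_⟩
  · obtain ⟨μ, hμ⟩ := MvPolynomial.support_nonempty.2 hP0
    -- If the representative vanished near `Θ x`, its pullback would be the zero germ, although `μ`
    -- is in the support.
    refine ⟨⟨μ, hμ⟩, fun hz => MvPolynomial.mem_support_iff.1 hμ (Subtype.ext ?_)⟩
    refine (hPa ⟨μ, hμ⟩).trans (germ_eq_zero_iff.2 ?_)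
    exact hΘ.continuousAt.eventually hz
  · let φ : analyticFunctionsAt x →+* AnalyticGerm x := Ideal.Quotient.mk _
    have h1 : φ (∑ μ : P.support,
        (⟨fun y => a μ (Θ y), (ha μ).comp hΘ⟩ : analyticFunctionsAt x) *
        ∏ s, (⟨f s, hf s⟩ : analyticFunctionsAt x) ^ (μ : Fin m →₀ ℕ) s) = 0 := by
      rw [← hP, MvPolynomial.aeval_def, MvPolynomial.eval₂_eq', map_sum]
      refine Eq.trans (Finset.sum_congr rfl fun μ _ => ?_)
        (Finset.sum_coe_sort P.support fun μ => algebraMap (pullbackGerms hΘ) (AnalyticGerm x)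
          (MvPolynomial.coeff μ P) * ∏ s, germ (f s) (hf s) ^ μ s)
      rw [map_mul, map_prod]
      congr 1
      · exact (hPa μ).symm
    have h2 := Ideal.Quotient.eq_zero_iff_mem.1 h1
    refine Eventually.mono h2 fun y hy => ?_
    simpa using! hy

variable {M : Set (CSpace n d)} {Q : (Fin n → ℂ) × CSpace n d → Fin d → ℂ}
  {H K : CSpace n d → CSpace n d}

/-- If `M` is locally equivalent to a subset of a real-algebraic set of dimension `2n+d`, then any
`n+1` derivatives of `Q` in `z` satisfy a polynomial relation with coefficients analytic functions
of `(z, Q(z, ζ))`. -/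
theorem exists_relation_zMultiDeriv (hM : IsGenericSubmanifold d M)
    (hM0 : (0 : CSpace n d) ∈ M)
    (hQ : AnalyticAt ℂ Q 0) (hQ0 : Q 0 = 0)
    (hMQ : ∀ᶠ Z : CSpace n d in 𝓝 0, Z ∈ M → Z.2 = Q (Z.1, star Z))
    (hH : AnalyticAt ℂ H 0) (hK : AnalyticAt ℂ K (H 0)) (hKH : ∀ᶠ Z in 𝓝 0, K (H Z) = Z)
    (hHK : ∀ᶠ Y in 𝓝 (H 0), H (K Y) = Y) {V : Set (RealIdx n d → ℝ)}
    (hMV : ∀ᶠ Z in 𝓝 0, Z ∈ M → realCoords (H Z) ∈ V)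
    (hV : realAlgDim V = ((2 * n + d : ℕ) : WithBot ℕ∞))
    (i : Fin (n + 1) → Fin d) (α : Fin (n + 1) → Fin n → ℕ) :
    ∃ (S : Finset (Fin (n + 1) →₀ ℕ)) (a : S → CSpace n d → ℂ), (∀ μ, AnalyticAt ℂ (a μ) 0) ∧
      (∃ μ, ¬ ∀ᶠ Z in 𝓝 0, a μ Z = 0) ∧
      ∀ᶠ y in 𝓝 0, ∑ μ, a μ (segreMap Q y) *
        ∏ s, zMultiDeriv (α s) (fun x => Q x (i s)) y ^ (μ : Fin (n + 1) →₀ ℕ) s = 0 := by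
  have hΦ0 := segreMap_zero hQ0
  have hHΦ : AnalyticAt ℂ H (segreMap Q 0) := by rwa [hΦ0]
  have hKΦ : AnalyticAt ℂ K (H (segreMap Q 0)) := by rwa [hΦ0]
  have hKHΦ : ∀ᶠ Z in 𝓝 (segreMap Q 0), K (H Z) = Z := by rwa [hΦ0]
  obtain ⟨s, hs, t, ht, hZt, hζt⟩ :=
    exists_transcendence_generators hM hM0 hQ hMQ hHΦ hH hMV hV
  -- The decisive count: `2n + d = (n + d) + n`.
  have hcard : s ≤ Fintype.card (Fin n ⊕ Fin d) + n := by
    simp only [Fintype.card_sum, Fintype.card_fin]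
    omega
  have hreal := eventually_reality hM hM0 hQ hQ0 hMQ
  have hK0 : K (H 0) = 0 := hKH.self_of_nhds
  have hind := algebraicIndependent_targetConjGerm hH hK.continuousAt hK0 hHK
  have hind' := algebraicIndependent_targetGerm hQ hQ0 hHΦ hreal hK.continuousAt hK0 hHK
  have hsrc := exists_germDerivation_sourceGerm_eq hQ hHΦ hKΦ hKHΦ
  have hsrcT (k : Fin n ⊕ Fin d) (j : Fin n) : germDerivation (zDir n d) (sourceGerm hQ k) j ∈
      algebraicOver (pullbackGerms (analyticAt_segreMap hQ)) (targetConjGerm hH) :=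
    derivation_mem_algebraicOver (germDerivation (zDir n d)) (targetGerm_mem hQ hHΦ)
      (germDerivation_targetConjGerm hH) hind hcard t ht hZt hζt
      (fun l => sourceGerm hQ (Sum.inl l)) (germDerivation_sourceGerm_inl hQ)
      (fun l => hsrc (Sum.inl l)) (sourceGerm hQ k) (hsrc k) j
  have hpull : ∀ a ∈ pullbackGerms (analyticAt_segreMap hQ), ∀ j,
      germDerivation (zDir n d) a j ∈
        algebraicOver (pullbackGerms (analyticAt_segreMap hQ)) (targetConjGerm hH) := by
    intro a ha j
    obtain ⟨J, hJ, hJa⟩ := exists_germDerivation_pullback_eq hQ ha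
    rw [hJa, Finset.sum_apply]
    exact Subalgebra.sum_mem _ fun k _ =>
      Subalgebra.mul_mem _ (le_algebraicOver _ _ (hJ k)) (hsrcT k j)
  -- The component of `Q` is a coordinate of `segreMap Q`, hence in `A`; each differentiation in `z`
  -- then stays in the algebraic closure.
  have hmem (s) : ∃ h : AnalyticAt ℂ (zMultiDeriv (α s) fun x => Q x (i s)) 0,
      germ _ h ∈ algebraicOver (pullbackGerms (analyticAt_segreMap hQ)) (targetConjGerm hH) := by
    refine zMultiDeriv_induction (p := fun g => ∃ h : AnalyticAt ℂ g 0, germ g h ∈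
      algebraicOver (pullbackGerms (analyticAt_segreMap hQ)) (targetConjGerm hH)) ?_ (α s) ?_
    · rintro j g ⟨hg, hgT⟩
      refine ⟨hg.zDeriv j, ?_⟩
      have h1 := derivation_mem_algebraicOver_of_mem (germDerivation (zDir n d))
        (germDerivation_targetConjGerm hH) hpull hgT j
      rw [germDerivation_germ] at h1
      rwa [germ_eq_iff.2 (hg.zDeriv_eventuallyEq j)]
    · refine ⟨((coordCLM (Sum.inr (i s))).analyticAt _).comp (analyticAt_segreMap hQ),
        le_algebraicOver _ _ ?_⟩
      exact ⟨coordCLM (Sum.inr (i s)), (coordCLM _).analyticAt _, rfl⟩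
  choose hf hfT using hmem
  have hdep := not_algebraicIndependent_algebraicOver (targetGerm_mem hQ hHΦ) hind' hcard t hZt hζt
    _ hfT
  obtain ⟨S, a, ha, hne, hrel⟩ := exists_relation_of_not_algebraicIndependent _ _ hdep
  rw [hΦ0] at ha hne
  exact ⟨S, a, ha, hne, hrel⟩

end Relation

/-! ### Specialization of a relation with analytic coefficients -/

section Specialization

/-- A nonzero analytic germ has a nonzero leading coefficient along some line. -/
theorem AnalyticAt.exists_line_eq_pow_smul {F V : Type*} [NormedAddCommGroup F] [NormedSpace ℂ F]
    [NormedAddCommGroup V] [NormedSpace ℂ V] [CompleteSpace V] {f : F → V} (hf : AnalyticAt ℂ f 0)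
    (h : ¬ ∀ᶠ Z in 𝓝 0, f Z = 0) :
    ∃ (v : F) (k : ℕ) (g : ℂ → V), AnalyticAt ℂ g 0 ∧ g 0 ≠ 0 ∧
      ∀ᶠ t in 𝓝 (0 : ℂ), f (t • v) = t ^ k • g t := by
  obtain ⟨r, hr, hball⟩ := Metric.eventually_nhds_iff_ball.1 hf.eventually_analyticAt
  obtain ⟨v, hv, hfv⟩ : ∃ v ∈ Metric.ball (0 : F) r, f v ≠ 0 := by
    by_contra hz
    push Not at hz
    exact h (Metric.eventually_nhds_iff_ball.2 ⟨r, hr, hz⟩)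
  have hline (t : ℂ) : AnalyticAt ℂ (fun t : ℂ => t • v) t :=
    analyticAt_id.smul analyticAt_const
  -- The complex line through a point `v` with `f v ≠ 0`. `U` is convex and contains `0` and `1`, so
  -- `f (t • v)` is not identically zero near `t = 0` and has a finite order `k`.
  let U : Set ℂ := (fun t : ℂ => t • v) ⁻¹' Metric.ball (0 : F) r
  have hU : Convex ℝ U :=
    (convex_ball (0 : F) r).is_linear_preimage ⟨fun a b => add_smul a b v,
      fun c a => smul_assoc c a v⟩
  have han : AnalyticOnNhd ℂ (fun t : ℂ => f (t • v)) U := fun t ht =>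
    AnalyticAt.comp (g := f) (hball _ ht) (hline t)
  have h0 : (0 : ℂ) ∈ U := by
    simp only [U, Set.mem_preimage, zero_smul]
    exact Metric.mem_ball_self hr
  have h1 : (1 : ℂ) ∈ U := by
    simpa only [U, Set.mem_preimage, one_smul] using hv
  have hne : ¬ ∀ᶠ t in 𝓝 (0 : ℂ), f (t • v) = 0 := by
    intro hz
    have := han.eqOn_zero_of_preconnected_of_eventuallyEq_zero hU.isPreconnected h0 hz h1
    simp only [one_smul] at this
    exact hfv this
  obtain ⟨k, g, hg, hg0, hfg⟩ := (han 0 h0).exists_eventuallyEq_pow_smul_nonzero_iff.2 hne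
  refine ⟨v, k, g, hg, hg0, hfg.mono fun t ht => ?_⟩
  simpa only [sub_zero] using ht

/-- Specialization: a linear relation with coefficients depending on a parameter `y` specializes to
a nontrivial relation at `y = 0`. -/
theorem exists_specialized_relation {X Y S : Type*} [NormedAddCommGroup X]
    [NormedAddCommGroup Y] [NormedSpace ℂ Y] [Fintype S] {a : S → Y → ℂ} {b : S → X × Y → ℂ}
    (ha : ∀ μ, AnalyticAt ℂ (a μ) 0) (hne : ∃ μ, ¬ ∀ᶠ y in 𝓝 0, a μ y = 0)
    (hb : ∀ μ, ∀ᶠ p in 𝓝 0, ContinuousAt (b μ) p)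
    (h : ∀ᶠ p in 𝓝 0, ∑ μ, a μ p.2 * b μ p = 0) :
    ∃ c : S → ℂ, c ≠ 0 ∧ ∀ᶠ x in 𝓝 0, ∑ μ, c μ * b μ (x, 0) = 0 := by
  have hA : AnalyticAt ℂ (fun y μ => a μ y) 0 := AnalyticAt.pi ha
  -- The coefficients are treated as one vector: removing the common power `t ^ k` leaves a nonzero
  -- vector `g 0`, although each `a μ 0` may be zero.
  obtain ⟨v, k, g, hg, hg0, hfg⟩ := hA.exists_line_eq_pow_smul (by
    intro hz
    obtain ⟨μ, hμ⟩ := hne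
    exact hμ (hz.mono fun y hy => congrFun hy μ))
  refine ⟨g 0, hg0, ?_⟩
  have hprod : (𝓝 (0 : X × Y)) = 𝓝 ((0 : X), (0 : Y)) := rfl
  have hb' : ∀ᶠ p in 𝓝 ((0 : X), (0 : Y)), ∀ μ, ContinuousAt (b μ) p := eventually_all.2 hb
  rw [hprod] at h
  filter_upwards [h.curry_nhds, hb'.curry_nhds] with x hx hbx
  have hbx0 := hbx.self_of_nhds
  have hline : Tendsto (fun t : ℂ => t • v) (𝓝 0) (𝓝 0) := by
    have : Continuous fun t : ℂ => t • v := by fun_prop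
    simpa using this.tendsto 0
  have hcont : Tendsto (fun t : ℂ => ∑ μ, g t μ * b μ (x, t • v)) (𝓝 0)
      (𝓝 (∑ μ, g 0 μ * b μ (x, 0))) := by
    refine tendsto_finsetSum _ fun μ _ => Tendsto.mul ?_ ?_
    · exact ((continuous_apply μ).tendsto _).comp hg.continuousAt.tendsto
    · exact (hbx0 μ).tendsto.comp (tendsto_const_nhds.prodMk_nhds hline)
  -- For `t ≠ 0` the factor `t ^ k` cancels; continuity in `t` then gives the relation at `t = 0`.
  have hzero : ∀ᶠ t : ℂ in 𝓝[≠] 0, ∑ μ, g t μ * b μ (x, t • v) = 0 := by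
    refine eventually_nhdsWithin_iff.2 ?_
    filter_upwards [hfg, hline.eventually hx] with t h1 h2 ht
    have h3 : t ^ k * ∑ μ, g t μ * b μ (x, t • v) = 0 := by
      rw [← h2, Finset.mul_sum]
      refine Finset.sum_congr rfl fun μ _ => ?_
      have h4 := congrFun h1 μ
      simp only [Pi.smul_apply, smul_eq_mul] at h4
      rw [h4, mul_assoc]
    exact (mul_eq_zero.1 h3).resolve_left (pow_ne_zero _ ht)
  exact tendsto_nhds_unique (hcont.mono_left (nhdsWithin_le_nhds (s := {0}ᶜ)))
    (tendsto_const_nhds.congr' (hzero.mono fun t ht => ht.symm))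

end Specialization

/-! ### Restriction to the Segre variety and analytic continuation -/

section Main

variable {n d : ℕ} {Q : (Fin n → ℂ) × CSpace n d → Fin d → ℂ}

/-- The point of the complexification over `(z, w)` with coordinate `χ`. -/
noncomputable def conjPoint (Q : (Fin n → ℂ) × CSpace n d → Fin d → ℂ)
    (y : (Fin n → ℂ) × CSpace n d) : (Fin n → ℂ) × CSpace n d :=
  (y.2.1, (y.1, conjFun Q y))

theorem AnalyticAt.conjPoint {y : (Fin n → ℂ) × CSpace n d} (hQ : AnalyticAt ℂ Q (star y)) :
    AnalyticAt ℂ (conjPoint Q) y := by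
  have h1 : AnalyticAt ℂ (fun x : (Fin n → ℂ) × CSpace n d => x.2.1) y :=
    AnalyticAt.comp (g := Prod.fst) analyticAt_fst analyticAt_snd
  exact h1.prod (analyticAt_fst.prod (AnalyticAt.conjFun hQ))

/-- Local version of the dependence: near `0` the derivatives of `Q` in `z` along the Segre variety
of `0` satisfy a polynomial relation. -/
theorem exists_local_polynomial (hQ : AnalyticAt ℂ Q 0) (hQ0 : Q 0 = 0)
    (hreal : ∀ᶠ x : (Fin n → ℂ) × CSpace n d in 𝓝 0, Q (x.2.1, (x.1, conjFun Q x)) = x.2.2)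
    {m : ℕ} {f : Fin m → (Fin n → ℂ) × CSpace n d → ℂ} (hf : ∀ s, AnalyticAt ℂ (f s) 0)
    {S : Finset (Fin m →₀ ℕ)} {a : S → CSpace n d → ℂ} (ha : ∀ μ, AnalyticAt ℂ (a μ) 0)
    (hne : ∃ μ, ¬ ∀ᶠ Z in 𝓝 0, a μ Z = 0)
    (hrel : ∀ᶠ y in 𝓝 0, ∑ μ, a μ (segreMap Q y) * ∏ s, f s y ^ (μ : Fin m →₀ ℕ) s = 0) :
    ∃ P : MvPolynomial (Fin m) ℂ, P ≠ 0 ∧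
      ∀ᶠ χ in 𝓝 0, MvPolynomial.eval (fun s => f s (conjPoint Q (χ, 0))) P = 0 := by
  have hW : AnalyticAt ℂ (conjPoint Q) 0 := AnalyticAt.conjPoint (by rwa [star_zero])
  have hW0 : conjPoint Q 0 = 0 := by
    have : conjFun Q 0 = 0 := by rw [conjFun, star_zero, hQ0, star_zero]
    rw [conjPoint, this]
    rfl
  have hWt : Tendsto (conjPoint Q) (𝓝 0) (𝓝 0) := by
    have := hW.continuousAt.tendsto
    rwa [hW0] at this
  have hb (μ : S) : AnalyticAt ℂ
      (fun y => ∏ s, f s (conjPoint Q y) ^ (μ : Fin m →₀ ℕ) s) 0 := by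
    refine Finset.analyticAt_fun_prod _ fun s _ => ?_
    refine AnalyticAt.pow (AnalyticAt.comp (g := f s) ?_ hW) _
    rw [hW0]
    exact hf s
  -- In the coordinates `(χ, Z)` supplied by `conjPoint`, reality turns `segreMap Q` into the
  -- projection to `Z`. The coefficients thus depend on `Z` alone, and `Z` is specialized to `0`.
  obtain ⟨c, hc, hrel'⟩ := exists_specialized_relation ha hne
    (b := fun (μ : S) y => ∏ s, f s (conjPoint Q y) ^ (μ : Fin m →₀ ℕ) s)
    (fun μ => (hb μ).eventually_analyticAt.mono fun y hy => hy.continuousAt) (by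
      filter_upwards [hWt.eventually hrel, hreal] with y h1 h2
      have h3 : segreMap Q (conjPoint Q y) = y.2 := Prod.ext rfl h2
      rwa [h3] at h1)
  refine ⟨∑ μ : S, MvPolynomial.monomial (μ : Fin m →₀ ℕ) (c μ), fun h0 => hc ?_, ?_⟩
  · ext ν
    have h1 := congrArg (MvPolynomial.coeff (ν : Fin m →₀ ℕ)) h0
    rw [MvPolynomial.coeff_sum, MvPolynomial.coeff_zero, Finset.sum_eq_single ν] at h1
    · simpa using h1
    · intro μ _ hμ
      rw [MvPolynomial.coeff_monomial, if_neg fun h => hμ (Subtype.ext h)]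
    · simp
  · filter_upwards [hrel'] with χ hχ
    rw [map_sum, ← hχ]
    refine Finset.sum_congr rfl fun μ _ => ?_
    rw [MvPolynomial.eval_monomial, Finsupp.prod_fintype _ _ fun _ => pow_zero _]

/-- Analytic continuation of a relation along the connected component of the Segre variety. -/
theorem eval_eq_zero_of_mem_segreComponent {Ω : Set ((Fin n → ℂ) × CSpace n d)}
    (hΩ0 : (0 : (Fin n → ℂ) × CSpace n d) ∈ Ω)
    (hQ : AnalyticOnNhd ℂ Q Ω) (hQ0 : Q 0 = 0) {m : ℕ}
    {f : Fin m → (Fin n → ℂ) × CSpace n d → ℂ} (hf : ∀ s, AnalyticOnNhd ℂ (f s) Ω)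
    {P : MvPolynomial (Fin m) ℂ}
    (hP : ∀ᶠ χ in 𝓝 0, MvPolynomial.eval (fun s => f s (conjPoint Q (χ, 0))) P = 0)
    {ζ : CSpace n d} (hζ : ζ ∈ segreComponent Ω Q) :
    MvPolynomial.eval (fun s => f s (0, star ζ)) P = 0 := by
  -- The parameters `χ` at which both `Q̄(χ, 0)` and the `f s` at the resulting point are analytic;
  -- continuation takes place in its component of `0`.
  let D : Set (Fin n → ℂ) := {χ | star (χ, (0 : CSpace n d)) ∈ Ω ∧ conjPoint Q (χ, 0) ∈ Ω}
  have han : AnalyticOnNhd ℂ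
      (fun χ => MvPolynomial.eval (fun s => f s (conjPoint Q (χ, 0))) P)
      (connectedComponentIn D 0) := by
    intro χ hχ
    obtain ⟨h1, h2⟩ := connectedComponentIn_subset _ _ hχ
    have h3 : AnalyticAt ℂ (fun χ : Fin n → ℂ => conjPoint Q (χ, 0)) χ :=
      AnalyticAt.comp (g := conjPoint Q) (AnalyticAt.conjPoint (hQ _ h1))
        (analyticAt_id.prod analyticAt_const)
    have h4 (s) : AnalyticAt ℂ (fun χ : Fin n → ℂ => f s (conjPoint Q (χ, 0))) χ :=
      AnalyticAt.comp (g := f s) (hf s _ h2) h3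
    exact AnalyticAt.aeval_mvPolynomial h4 P
  -- Conjugating `w = Q(z, 0)` identifies `(0, ζ̄)` with the point of parameter `χ = z̄`.
  have hpt {ζ : CSpace n d} (hζ : ζ ∈ segreVariety Ω Q 0) :
      conjPoint Q (star ζ.1, 0) = (0, star ζ) := by
    have h1 : ζ.2 = Q (ζ.1, star 0) := hζ.2
    refine Prod.ext rfl (Prod.ext rfl ?_)
    have h2 : star (star ζ.1, (0 : CSpace n d)) = (ζ.1, star 0) :=
      Prod.ext (star_star _) rfl
    change star (Q (star (star ζ.1, (0 : CSpace n d)))) = star ζ.2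
    rw [h2, ← h1]
  have hmaps : ∀ ζ ∈ {ζ | ζ ∈ segreVariety Ω Q 0 ∧ ((0 : Fin n → ℂ), star ζ) ∈ Ω},
      star ζ.1 ∈ D := by
    rintro ζ ⟨h1, h2⟩
    refine ⟨?_, by rw [hpt h1]; exact h2⟩
    have h3 : star (star ζ.1, (0 : CSpace n d)) = (ζ.1, star 0) :=
      Prod.ext (star_star _) rfl
    rw [h3]
    exact h1.1
  have h0 : (0 : CSpace n d) ∈ {ζ | ζ ∈ segreVariety Ω Q 0 ∧ ((0 : Fin n → ℂ), star ζ) ∈ Ω} := by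
    have h1 : ((0 : Fin n → ℂ), star (0 : CSpace n d)) = 0 := by rw [star_zero]; rfl
    refine ⟨⟨?_, ?_⟩, ?_⟩
    · change ((0 : Fin n → ℂ), star (0 : CSpace n d)) ∈ Ω
      rwa [h1]
    · change (0 : Fin d → ℂ) = Q ((0 : Fin n → ℂ), star (0 : CSpace n d))
      rw [h1, hQ0]
    · rwa [h1]
  have hcont : Continuous fun ζ : CSpace n d => star ζ.1 := continuous_fst.star
  -- `ζ ↦ z̄` maps the Segre component to a connected subset of `D` through `0`, so the identity
  -- theorem in `χ` covers every such `ζ`.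
  have hsub : (fun ζ : CSpace n d => star ζ.1) '' segreComponent Ω Q ⊆
      connectedComponentIn D 0 := by
    refine IsPreconnected.subset_connectedComponentIn
      (isPreconnected_connectedComponentIn.image _ hcont.continuousOn) ?_ ?_
    · exact ⟨0, mem_connectedComponentIn h0, star_zero _⟩
    · rintro _ ⟨ζ, hζ, rfl⟩
      exact hmaps ζ (connectedComponentIn_subset _ _ hζ)
  have h0D : (0 : Fin n → ℂ) ∈ D := by
    have := hmaps 0 h0
    rwa [Prod.fst_zero, star_zero] at this
  have key := han.eqOn_zero_of_preconnected_of_eventuallyEq_zero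
    isPreconnected_connectedComponentIn (mem_connectedComponentIn h0D) hP (hsub ⟨ζ, hζ, rfl⟩)
  simp only [hpt (connectedComponentIn_subset _ _ hζ).1] at key
  exact key

end Main

theorem theoremA1 (n d : ℕ)
    (M : Set (CSpace n d)) (hM : IsGenericSubmanifold d M) (hM0 : (0 : CSpace n d) ∈ M)
    (Ω : Set ((Fin n → ℂ) × CSpace n d)) (hΩ : IsOpen Ω) (hΩ0 : (0 : (Fin n → ℂ) × CSpace n d) ∈ Ω)
    (Q : (Fin n → ℂ) × CSpace n d → Fin d → ℂ) (hQ : AnalyticOnNhd ℂ Q Ω)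
    (hMQ : ∀ᶠ Z : CSpace n d in 𝓝 0, Z ∈ M ↔ Z.2 = Q (Z.1, star Z))
    (M' : Set (CSpace n d)) (hM' : IsRealAlgebraicGenericSubmanifold M')
    (hMM' : BiholomorphicallyEquivalentAt M 0 M')
    (i : Fin (n + 1) → Fin d) (α : Fin (n + 1) → Fin n → ℕ) :
    ∃ P : MvPolynomial (Fin (n + 1)) ℂ, P ≠ 0 ∧
      ∀ ζ ∈ segreComponent Ω Q,
        MvPolynomial.eval
          (fun s => multiDeriv (α s) (fun z => Q (z, star ζ) (i s)) 0) P = 0 := by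
  obtain ⟨H, hH0, hH, hHs, hHM⟩ := hMM'
  obtain ⟨-, I, hI, hdim⟩ := hM'
  have hQat : AnalyticAt ℂ Q 0 := hQ 0 hΩ0
  have hQ0 : Q 0 = 0 := by
    have h1 : (0 : CSpace n d).2 = Q ((0 : CSpace n d).1, star (0 : CSpace n d)) :=
      hMQ.self_of_nhds.1 hM0
    rw [star_zero] at h1
    exact h1.symm
  have hMQ' : ∀ᶠ Z : CSpace n d in 𝓝 0, Z ∈ M → Z.2 = Q (Z.1, star Z) :=
    hMQ.mono fun Z hZ => hZ.1
  have hMV : ∀ᶠ Z in 𝓝 0, Z ∈ M → realCoords (H Z) ∈ MvPolynomial.zeroLocus ℝ I := by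
    filter_upwards [H.open_source.mem_nhds hH0] with Z hZ hZM
    have h1 : H Z ∈ H '' (M ∩ H.source) := ⟨Z, ⟨hZM, hZ⟩, rfl⟩
    rw [hHM] at h1
    exact hI _ h1.1
  obtain ⟨S, a, ha, hne, hrel⟩ := exists_relation_zMultiDeriv hM hM0 hQat hQ0 hMQ' (hH 0 hH0)
    (hHs _ (H.map_source hH0)) (H.eventually_left_inverse hH0)
    (H.eventually_right_inverse (H.map_source hH0)) hMV hdim i α
  have hQi (s : Fin (n + 1)) : AnalyticOnNhd ℂ (fun x => Q x (i s)) Ω := fun x hx =>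
    ((ContinuousLinearMap.proj (R := ℂ) (φ := fun _ : Fin d => ℂ) (i s)).analyticAt _).comp (hQ x hx)
  have hf (s : Fin (n + 1)) : AnalyticOnNhd ℂ (zMultiDeriv (α s) fun x => Q x (i s)) Ω :=
    fun x hx => (hQi s x hx).zMultiDeriv (α s)
  obtain ⟨P, hP, hP0⟩ := exists_local_polynomial hQat hQ0
    (eventually_reality hM hM0 hQat hQ0 hMQ') (fun s => hf s 0 hΩ0) ha hne hrel
  refine ⟨P, hP, fun ζ hζ => ?_⟩
  have h1 := eval_eq_zero_of_mem_segreComponent hΩ0 hQ hQ0 hf hP0 hζ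
  simpa only [zMultiDeriv_apply] using h1
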